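/- **Setting.** Programs of $\mathsf{cqWhile}$ act on classical variables with values in a nonempty set and on finitely many quantum variables $q$ with Hilbert spaces $\mathbb{C}^{d(q)}$, $d(q)\ge 1$. They are built from $\mathsf{skip}$, $\mathsf{abort}$, assignments $x:=e$, sampling $x\xleftarrow{\$}\mu$ from a discrete probability distribution $\mu$, initialization of a register in a pure state $|v\rangle$, application of a unitary $U$ to a register, measurement $x:=\mathsf{meas}\,M$ of a register (with $\sum_i M_i^\dagger M_i=I$), sequencing, conditionals and while loops; $\mathsf{skip};c$ and $c;\mathsf{skip}$ are identified with $c$. A *state* $\Delta$ assigns to every classical memory $\sigma$ a positive semidefinite operator $\Delta(\sigma)$, with total trace at most $1$; $[\![c]\!]$ is the usual denotational semantics on states. A program is *almost surely terminating* ($\mathsf{AST}$) if $[\![c]\!]$ preserves the total trace of every state, and $\mathsf{HAST}$ if it and all its subprograms are $\mathsf{AST}$. An *assertion* $\phi$ assigns to every classical memory a positive operator with eigenvalues in $[0,\infty]$, and $\mathbb{E}_\Delta[\phi]=\sum_\sigma \mathrm{tr}(\phi(\sigma)\Delta(\sigma))$, with $0\cdot\infty=0$. Relational assertions and states live on pairs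 of memories and on the tensor product of the two quantum systems; $\mathrm{tr}_2$ and $\mathrm{tr}_1$ give the left and the right marginal of a relational state. A coupling of $\langle\Delta_1,\Delta_2\rangle$ is a relational state with left marginal $\Delta_1$ and right marginal $\Delta_2$. The guarded assertion $b\mid\psi$ equals $\psi$ where $b$ holds and $\infty\cdot id$ elsewhere. The judgment $\{\psi\}\,c_1\sim c_2\,\{\phi\}$ is *valid*, $\vDash\{\psi\}\,c_1\sim c_2\,\{\phi\}$, if for every relational state $\Delta$ there is a coupling $\Delta'$ of $\langle[\![c_1]\!](\mathrm{tr}_2\Delta),[\![c_2]\!](\mathrm{tr}_1\Delta)\rangle$ with $\mathbb{E}_{\Delta'}[\phi]\le\mathbb{E}_\Delta[\psi]$. The *one-sided fragment* of the proof system cqOTL consists of * Skip: $\{\psi\}\,\mathsf{skip}\sim\mathsf{skip}\,\{\psi\}$; * Seq: from $\{\psi\}\,c_1\sim c_2\,\{\xi\}$ and $\{\xi\}\,c_1'\sim c_2'\,\{\phi\}$ infer $\{\psi\}\,c_1;c_1'\sim c_2;c_2'\,\{\phi\}$; * Conseq: from $\{\psi'\}\,c_1\sim c_2\,\{\phi'\}$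 infer $\{\psi\}\,c_1\sim c_2\,\{\phi\}$, provided that for all states $\Delta,\Delta_1,\Delta_2$, $\mathbb{E}_\Delta[\psi']\ge\inf_{\Delta'}\mathbb{E}_{\Delta'}[\phi']$ implies $\mathbb{E}_\Delta[\psi]\ge\inf_{\Delta'}\mathbb{E}_{\Delta'}[\phi]$, the infima being over the couplings $\Delta'$ of $\langle\Delta_1,\Delta_2\rangle$; * the following left rules, and the symmetric right rules: * If: from $\{b\mid\psi\}\,c_1\sim c_2\,\{\phi\}$ and $\{\neg b\mid\psi\}\,c_1'\sim c_2\,\{\phi\}$ infer $\{\psi\}\,\mathsf{if}\ b\ \mathsf{then}\ c_1\ \mathsf{else}\ c_1'\sim c_2\,\{\phi\}$; * While: from $\{b\mid\psi\}\,c\sim\mathsf{skip}\,\{\psi\}$ infer $\{\psi\}\,\mathsf{while}\ b\ \mathsf{do}\ c\sim\mathsf{skip}\,\{\neg b\mid\psi\}$, if the loop is $\mathsf{AST}$; * the axioms $\{\psi'\}\,c\sim\mathsf{skip}\,\{\psi\}$ with $\psi'=\psi[e/x]$ for $c$ an assignment, $\psi'=\mathbb{E}_{v\sim\mu}[\psi[v/x]]$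 for a sampling, $\psi'=\sum_i|i\rangle\langle v|\psi|v\rangle\langle i|$ for an initialization, $\psi'=U^\dagger\psi U$ for a unitary, $\psi'=\sum_i M_i^\dagger\,\psi[i/x]\,M_i$ for a measurement. The full system adds two-sided rules (assignment, conditional, loop, and sampling and measurement through coupling conditions) and the structural rules NMod, Unbounded-Duality and Limit. **Theorem 8.6** (Completeness for split postconditions). Let $c_1,c_2$ be $\mathsf{HAST}$ programs, $\psi$ a relational assertion, and $\phi_1$, $\phi_2$ assertions on the left and on the right. If $$\vDash\{\psi\}\;c_1\sim c_2\;\{\phi_1\otimes id+id\otimes\phi_2\},$$ then $$\vdash\{\psi\}\;c_1\sim c_2\;\{\phi_1\otimes id+id\otimes\phi_2\}$$ in cqOTL, and a derivation exists already in the one-sided fragment. -/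

import Mathlib

open scoped ENNReal Matrix ComplexOrder

namespace CqOTL

/-- A nonnegative quadratic form with values in `[0, ∞]`. -/
structure IsForm {ι : Type*} (q : (ι → ℂ) → ℝ≥0∞) : Prop where
  homog : ∀ (c : ℂ) (x : ι → ℂ), q (c • x) = ‖c‖ₑ ^ 2 * q x
  parallelogram : ∀ x y : ι → ℂ, q (x + y) + q (x - y) = 2 * (q x + q y)

/-- `q x = ∑ i, l i * |⟨u i, x⟩|²` for the orthonormal basis formed by the columns of `U`. -/
def IsSpectral {ι : Type*} [Fintype ι] [DecidableEq ι] (q : (ι → ℂ) → ℝ≥0∞)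
    (U : Matrix ι ι ℂ) (l : ι → ℝ≥0∞) : Prop :=
  U ∈ Matrix.unitaryGroup ι ℂ ∧ ∀ x, q x = ∑ i, l i * ‖(Uᴴ *ᵥ x) i‖ₑ ^ 2

theorem IsSpectral.isForm {ι : Type*} [Fintype ι] [DecidableEq ι] {q : (ι → ℂ) → ℝ≥0∞}
    {U : Matrix ι ι ℂ} {l : ι → ℝ≥0∞} (h : IsSpectral q U l) : IsForm q := by
  have hz : ∀ z w : ℂ, ‖z + w‖ₑ ^ 2 + ‖z - w‖ₑ ^ 2 = 2 * (‖z‖ₑ ^ 2 + ‖w‖ₑ ^ 2) := by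
    intro z w
    have := parallelogram_law_with_norm ℝ z w
    have h2 : ‖z + w‖₊ ^ 2 + ‖z - w‖₊ ^ 2 = 2 * (‖z‖₊ ^ 2 + ‖w‖₊ ^ 2) := by
      apply NNReal.coe_injective
      push_cast
      nlinarith [this]
    change (‖z + w‖₊ : ℝ≥0∞) ^ 2 + (‖z - w‖₊ : ℝ≥0∞) ^ 2
      = 2 * ((‖z‖₊ : ℝ≥0∞) ^ 2 + (‖w‖₊ : ℝ≥0∞) ^ 2)
    exact_mod_cast h2
  constructor
  · intro c x
    rw [h.2, h.2, Finset.mul_sum]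
    refine Finset.sum_congr rfl fun i _ => ?_
    rw [Matrix.mulVec_smul, Pi.smul_apply, smul_eq_mul, enorm_mul]
    ring
  · intro x y
    rw [h.2, h.2, h.2, h.2, ← Finset.sum_add_distrib, ← Finset.sum_add_distrib, Finset.mul_sum]
    refine Finset.sum_congr rfl fun i _ => ?_
    rw [Matrix.mulVec_add, Matrix.mulVec_sub, Pi.add_apply, Pi.sub_apply, ← mul_add, hz]
    ring

/-- An additive function on the reals that is bounded on `[-1, 1]` is linear. -/
theorem linear_of_bounded (f : ℝ → ℝ) (hadd : ∀ s t, f (s + t) = f s + f t) (K : ℝ)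
    (hK : ∀ t, |t| ≤ 1 → |f t| ≤ K) (t : ℝ) : f t = t * f 1 := by
  let F : ℝ →+ ℝ := AddMonoidHom.mk' f hadd
  let G : ℝ →+ ℝ := F - (AddMonoidHom.mulRight (f 1))
  have hG : ∀ s, G s = f s - s * f 1 := fun s => rfl
  have hint : ∀ n : ℤ, G n = 0 := by
    intro n
    have : G ((n : ℤ) • (1 : ℝ)) = n • G 1 := map_zsmul G n 1
    rw [hG 1] at this
    simpa using this
  have hb : ∀ s, |G s| ≤ K + |f 1| := by
    intro s
    have h1 : G s = G (Int.fract s) := by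
      conv_lhs => rw [← Int.floor_add_fract s]
      rw [map_add, hint, zero_add]
    have h2 : |Int.fract s| ≤ 1 := by
      rw [abs_of_nonneg (Int.fract_nonneg s)]; exact (Int.fract_lt_one s).le
    rw [h1, hG]
    calc _ ≤ |f (Int.fract s)| + |Int.fract s * f 1| := abs_sub _ _
      _ ≤ K + |f 1| := by
        rw [abs_mul]
        have := hK _ h2
        have := mul_le_mul_of_nonneg_right h2 (abs_nonneg (f 1))
        linarith
  have hz : G t = 0 := by
    by_contra hne
    have hpos : 0 < |G t| := abs_pos.mpr hne
    obtain ⟨n, hn⟩ := exists_nat_gt ((K + |f 1|) / |G t|)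
    have h1 := hb ((n : ℕ) • t)
    rw [map_nsmul, nsmul_eq_mul, abs_mul, Nat.abs_cast] at h1
    rw [div_lt_iff₀ hpos] at hn
    linarith
  rw [hG] at hz
  linarith

/-- Jordan and von Neumann: a finite nonnegative quadratic form is given by a matrix. -/
theorem exists_matrix_of_form {ι : Type*} [Fintype ι] [DecidableEq ι] (g : (ι → ℂ) → ℝ)
    (h0 : ∀ x, 0 ≤ g x) (hh : ∀ (c : ℂ) (x : ι → ℂ), g (c • x) = ‖c‖ ^ 2 * g x)
    (hp : ∀ x y : ι → ℂ, g (x + y) + g (x - y) = 2 * (g x + g y)) :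
    ∃ T : Matrix ι ι ℂ, T.IsHermitian ∧ ∀ x, star x ⬝ᵥ (T *ᵥ x) = (g x : ℂ) := by
  have hneg : ∀ x, g (-x) = g x := by
    intro x; have := hh (-1) x; simpa using this
  have hg0 : g 0 = 0 := by have := hh 0 0; simpa using this
  let B : (ι → ℂ) → (ι → ℂ) → ℝ := fun x y => (g (x + y) - g (x - y)) / 4
  have hBdef : ∀ x y, B x y = (g (x + y) - g (x - y)) / 4 := fun _ _ => rfl
  have hBsymm : ∀ x y, B x y = B y x := by
    intro x y
    rw [hBdef, hBdef, add_comm x y, ← hneg (x - y), neg_sub]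
  have hBadd : ∀ x y z, B (x + y) z = B x z + B y z := by
    intro x y z
    have e1 := hp (x + z) y
    have e2 := hp (y + z) x
    have e3 := hp (x - z) y
    have e4 := hp (y - z) x
    have n1 := hneg (y + z - x)
    have n2 := hneg (x + z - y)
    rw [show x + z + y = x + y + z by abel] at e1
    rw [show y + z + x = x + y + z by abel] at e2
    rw [show x - z + y = x + y - z by abel, show x - z - y = -(y + z - x) by abel, n1] at e3
    rw [show y - z + x = x + y - z by abel, show y - z - x = -(x + z - y) by abel, n2] at e4
    simp only [hBdef]
    linarith
  have hBadd' : ∀ x y z, B x (y + z) = B x y + B x z := by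
    intro x y z
    rw [hBsymm, hBadd, hBsymm y, hBsymm z]
  have hBbd : ∀ x y, |B x y| ≤ (g x + g y) / 2 := by
    intro x y
    have := hp x y
    have := h0 (x + y)
    have := h0 (x - y)
    rw [hBdef, abs_le]
    constructor <;> linarith
  have hBreal : ∀ (t : ℝ) x y, B ((t : ℂ) • x) y = t * B x y := by
    intro t x y
    have := linear_of_bounded (fun s => B ((s : ℂ) • x) y)
      (fun s u => by simp only [Complex.ofReal_add, add_smul, hBadd]) ((g x + g y) / 2)
      (fun s hs => by
        refine (hBbd _ _).trans ?_
        have h1 := hh (s : ℂ) x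
        rw [Complex.norm_real, Real.norm_eq_abs] at h1
        have h2 : |s| ^ 2 * g x ≤ 1 * g x := by
          refine mul_le_mul_of_nonneg_right ?_ (h0 x)
          exact pow_le_one₀ (abs_nonneg s) hs
        linarith) t
    simpa using this
  have hBI : ∀ x y, B (Complex.I • x) (Complex.I • y) = B x y := by
    intro x y
    rw [hBdef, ← smul_add, ← smul_sub, hh, hh, hBdef]
    simp
  have hBI' : ∀ x y, B (Complex.I • x) y = - B x (Complex.I • y) := by
    intro x y
    have h1 := hBI (Complex.I • x) y
    rw [smul_smul, Complex.I_mul_I] at h1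
    have h2 := hBreal (-1) x (Complex.I • y)
    push_cast at h2
    rw [h2] at h1
    linarith
  have hBself : ∀ x, B x x = g x := by
    intro x
    have := hh 2 x
    rw [hBdef, sub_self, hg0, ← two_smul ℂ x, this]
    norm_num
  let H : (ι → ℂ) → (ι → ℂ) → ℂ := fun x y => (B x y : ℂ) - Complex.I * (B x (Complex.I • y) : ℂ)
  have hHadd : ∀ x y z, H x (y + z) = H x y + H x z := by
    intro x y z
    simp only [H, smul_add, hBadd', Complex.ofReal_add]; ring
  have hBreal' : ∀ (t : ℝ) x y, B x ((t : ℂ) • y) = t * B x y := by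
    intro t x y
    rw [hBsymm, hBreal, hBsymm]
  have hHsmul : ∀ (c : ℂ) x y, H x (c • y) = c * H x y := by
    intro c x y
    have e1 : c • y = (c.re : ℂ) • y + (c.im : ℂ) • (Complex.I • y) := by
      rw [smul_smul, ← add_smul, Complex.re_add_im]
    have e2 : B x (Complex.I • (Complex.I • y)) = - B x y := by
      rw [smul_smul, Complex.I_mul_I]
      have h2 := hBreal' (-1) x y
      push_cast at h2
      rw [h2]; ring
    have e3 : B x (c • y) = c.re * B x y + c.im * B x (Complex.I • y) := by
      rw [e1, hBadd', hBreal', hBreal']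
    have e4 : B x (Complex.I • (c • y)) = c.re * B x (Complex.I • y) - c.im * B x y := by
      rw [e1, smul_add, hBadd', smul_comm Complex.I (c.re : ℂ), hBreal',
        smul_comm Complex.I (c.im : ℂ), hBreal', e2]
      ring
    simp only [H]
    rw [e3, e4]
    apply Complex.ext
    · simp
    · simp; ring
  have hHconj : ∀ x y, H y x = star (H x y) := by
    intro x y
    have h1 : B y (Complex.I • x) = - B x (Complex.I • y) := by rw [hBsymm, hBI']
    simp only [H]
    rw [h1, hBsymm y x]
    apply Complex.ext <;> simp
  have hHself : ∀ x, H x x = g x := by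
    intro x
    have h1 : B x (Complex.I • x) = 0 := by
      have := hBI' x x
      rw [hBsymm] at this
      linarith
    simp only [H]
    rw [h1, hBself]; simp
  let HL : (ι → ℂ) → ((ι → ℂ) →ₗ[ℂ] ℂ) := fun x =>
    { toFun := H x, map_add' := hHadd x, map_smul' := fun c y => hHsmul c x y }
  have hexp : ∀ x y, H x y = ∑ k, y k * H x (Pi.single k 1) := by
    intro x y
    have h1 : y = ∑ k, y k • (Pi.single k (1 : ℂ) : ι → ℂ) := by
      ext j; simp [Finset.sum_apply, Pi.single_apply]
    conv_lhs => rw [h1]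
    change HL x _ = _
    rw [map_sum]
    refine Finset.sum_congr rfl fun k _ => ?_
    rw [map_smul]; rfl
  refine ⟨Matrix.of fun j k => H (Pi.single j 1) (Pi.single k 1), ?_, ?_⟩
  · ext j k
    rw [Matrix.conjTranspose_apply, Matrix.of_apply, Matrix.of_apply, ← hHconj]
  · intro x
    rw [← hHself, hexp x x]
    simp only [dotProduct, Matrix.mulVec, Matrix.of_apply]
    rw [show (∑ i, star x i * ∑ k, H (Pi.single i 1) (Pi.single k 1) * x k)
      = ∑ k, x k * ∑ i, star x i * H (Pi.single i 1) (Pi.single k 1) by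
        simp only [Finset.mul_sum]
        rw [Finset.sum_comm]
        refine Finset.sum_congr rfl fun k _ => Finset.sum_congr rfl fun i _ => by ring]
    refine Finset.sum_congr rfl fun k _ => ?_
    congr 1
    rw [hHconj (Pi.single k 1) x, hexp (Pi.single k 1) x, star_sum]
    refine Finset.sum_congr rfl fun i _ => ?_
    rw [star_mul', ← hHconj]; rfl


/-- Every `[0, ∞]`-valued quadratic form on `ℂ^ι` has a spectral decomposition. -/
theorem IsForm.exists_spectral {ι : Type*} [Fintype ι] [DecidableEq ι] {q : (ι → ℂ) → ℝ≥0∞}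
    (h : IsForm q) : ∃ U l, IsSpectral q U l := by
  have q0 : q 0 = 0 := by have := h.homog 0 0; simpa using this
  have hadd : ∀ x y, q x ≠ ∞ → q y ≠ ∞ → q (x + y) ≠ ∞ := by
    intro x y hx hy
    refine ne_top_of_le_ne_top ?_ (le_self_add.trans (h.parallelogram x y).le)
    exact ENNReal.mul_ne_top (by simp) (ENNReal.add_ne_top.mpr ⟨hx, hy⟩)
  have hsm : ∀ (c : ℂ) x, q x ≠ ∞ → q (c • x) ≠ ∞ := by
    intro c x hx
    rw [h.homog]
    exact ENNReal.mul_ne_top (by simp) hx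
  let W : Submodule ℂ (EuclideanSpace ℂ ι) :=
    { carrier := {x | q x.ofLp ≠ ∞}
      add_mem' := fun {x y} hx hy => by
        simp only [Set.mem_ofPred_eq, WithLp.ofLp_add]; exact hadd _ _ hx hy
      zero_mem' := by simp [q0]
      smul_mem' := fun c x hx => by
        simp only [Set.mem_ofPred_eq, WithLp.ofLp_smul]; exact hsm _ _ hx }
  have hW : ∀ x, x ∈ W ↔ q x.ofLp ≠ ∞ := fun x => Iff.rfl
  let P := W.starProjection
  have hPW : ∀ x, P x ∈ W := fun x => W.starProjection_apply_mem x
  let g : (ι → ℂ) → ℝ := fun x =>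
    (q (P (WithLp.toLp 2 x)).ofLp).toReal + ‖P (WithLp.toLp 2 x)‖ ^ 2
  have g0 : ∀ x, 0 ≤ g x := fun x => by positivity
  have gh : ∀ (c : ℂ) x, g (c • x) = ‖c‖ ^ 2 * g x := by
    intro c x
    simp only [g, WithLp.toLp_smul, map_smul, WithLp.ofLp_smul, h.homog, ENNReal.toReal_mul,
      norm_smul, ENNReal.toReal_pow, toReal_enorm]
    ring
  have gp : ∀ x y, g (x + y) + g (x - y) = 2 * (g x + g y) := by
    intro x y
    have hx := (hW _).1 (hPW (WithLp.toLp 2 x))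
    have hy := (hW _).1 (hPW (WithLp.toLp 2 y))
    have e1 := h.parallelogram (P (WithLp.toLp 2 x)).ofLp (P (WithLp.toLp 2 y)).ofLp
    have hm : q ((P (WithLp.toLp 2 x)).ofLp - (P (WithLp.toLp 2 y)).ofLp) ≠ ∞ := by
      have := hadd _ _ hx (hsm (-1) _ hy)
      rwa [neg_one_smul, ← sub_eq_add_neg] at this
    have e2 := congrArg ENNReal.toReal e1
    rw [ENNReal.toReal_add (hadd _ _ hx hy) hm, ENNReal.toReal_mul, ENNReal.toReal_add hx hy] at e2
    have e3 := parallelogram_law_with_norm ℝ (P (WithLp.toLp 2 x)) (P (WithLp.toLp 2 y))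
    simp only [g, WithLp.toLp_add, WithLp.toLp_sub, map_add, map_sub, WithLp.ofLp_add,
      WithLp.ofLp_sub]
    simp only [ENNReal.toReal_ofNat] at e2
    nlinarith [e2, e3]
  obtain ⟨T, hT, hTg⟩ := exists_matrix_of_form g g0 gh gp
  let U : Matrix ι ι ℂ := (hT.eigenvectorUnitary : Matrix ι ι ℂ)
  let m : ι → ℝ := hT.eigenvalues
  let u : ι → EuclideanSpace ℂ ι := fun i => hT.eigenvectorBasis i
  have hinner : ∀ i (x : ι → ℂ), (Uᴴ *ᵥ x) i = inner ℂ (u i) (WithLp.toLp 2 x) := by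
    intro i x
    simp only [Matrix.mulVec, dotProduct, U, u, Matrix.conjTranspose_apply,
      Matrix.IsHermitian.eigenvectorUnitary_apply, PiLp.inner_apply, RCLike.inner_apply]
    refine Finset.sum_congr rfl fun j _ => ?_
    rw [mul_comm]; rfl
  have hexpand : ∀ x : EuclideanSpace ℂ ι, x = ∑ i, inner ℂ (u i) x • u i :=
    fun x => (hT.eigenvectorBasis.sum_repr' x).symm
  have hTu : ∀ i, T *ᵥ (u i).ofLp = (m i : ℂ) • (u i).ofLp := by
    intro i
    rw [hT.mulVec_eigenvectorBasis]; rfl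
  have hgin : ∀ x : EuclideanSpace ℂ ι, (g x.ofLp : ℂ) = inner ℂ x (WithLp.toLp 2 (T *ᵥ x.ofLp)) := by
    intro x
    rw [← hTg, EuclideanSpace.inner_eq_star_dotProduct, dotProduct_comm]
  have hTx : ∀ x : EuclideanSpace ℂ ι, WithLp.toLp 2 (T *ᵥ x.ofLp)
      = ∑ i, ((m i : ℂ) * inner ℂ (u i) x) • u i := by
    intro x
    have h1 : x.ofLp = ∑ i, inner ℂ (u i) x • (u i).ofLp := by
      conv_lhs => rw [hexpand x]
      rw [WithLp.ofLp_sum]; rfl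
    conv_lhs => rw [h1]
    rw [Matrix.mulVec_sum, WithLp.toLp_sum]
    refine Finset.sum_congr rfl fun i _ => ?_
    rw [Matrix.mulVec_smul, hTu, smul_smul, mul_comm]
    rfl
  have hgsum : ∀ x : EuclideanSpace ℂ ι, g x.ofLp = ∑ i, m i * ‖inner ℂ (u i) x‖ ^ 2 := by
    intro x
    have h1 := hgin x
    rw [hTx, inner_sum] at h1
    have h2 : ∀ i, inner ℂ x (((m i : ℂ) * inner ℂ (u i) x) • u i)
        = ((m i * ‖inner ℂ (u i) x‖ ^ 2 : ℝ) : ℂ) := by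
      intro i
      rw [inner_smul_right, mul_assoc, ← inner_conj_symm x (u i), Complex.mul_conj,
        Complex.normSq_eq_norm_sq]
      push_cast; rfl
    rw [Finset.sum_congr rfl fun i _ => h2 i] at h1
    exact_mod_cast h1
  have hmg : ∀ i, g (u i).ofLp = m i := by
    intro i
    rw [hgsum, Finset.sum_eq_single i]
    · have : inner ℂ (u i) (u i) = (1 : ℂ) :=
        (hT.eigenvectorBasis.inner_eq_ite i i).trans (if_pos rfl)
      rw [this]; simp
    · intro j _ hj
      have : inner ℂ (u j) (u i) = (0 : ℂ) :=
        (hT.eigenvectorBasis.inner_eq_ite j i).trans (if_neg hj)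
      rw [this]; simp
    · simp
  have hm0 : ∀ i, 0 ≤ m i := fun i => by rw [← hmg]; exact g0 _
  have hzero : ∀ i, m i = 0 → u i ∈ Wᗮ := by
    intro i hi
    have h1 : g (u i).ofLp = 0 := by rw [hmg, hi]
    have h2 : P (u i) = 0 := by
      have h3 : (q (P (u i)).ofLp).toReal + ‖P (u i)‖ ^ 2 = 0 := h1
      have h4 : 0 ≤ (q (P (u i)).ofLp).toReal := ENNReal.toReal_nonneg
      have h5 : ‖P (u i)‖ ^ 2 = 0 := by nlinarith [sq_nonneg ‖P (u i)‖]
      simpa using h5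
    rwa [← Submodule.starProjection_apply_eq_zero_iff]
  have hnz : ∀ i, m i ≠ 0 → u i ∈ W := by
    intro i hi
    rw [← Submodule.orthogonal_orthogonal W, Submodule.mem_orthogonal]
    intro w hw
    have h1 : g w.ofLp = 0 := by
      have h2 : P w = 0 := by rwa [Submodule.starProjection_apply_eq_zero_iff]
      change (q (P w).ofLp).toReal + ‖P w‖ ^ 2 = 0
      rw [h2]; simp [q0]
    rw [hgsum, Finset.sum_eq_zero_iff_of_nonneg
      (fun i _ => mul_nonneg (hm0 i) (sq_nonneg _))] at h1
    have h3 := h1 i (Finset.mem_univ i)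
    have h4 : inner ℂ (u i) w = (0 : ℂ) := by simpa [hi] using h3
    rw [← inner_conj_symm, h4, map_zero]
  have hPid : ∀ x ∈ W, P x = x := fun x hx => Submodule.starProjection_eq_self_iff.mpr hx
  have hm1 : ∀ i, m i ≠ 0 → 1 ≤ m i := by
    intro i hi
    have h1 : (q (P (u i)).ofLp).toReal + ‖P (u i)‖ ^ 2 = m i := hmg i
    have h2 : ‖u i‖ = 1 := hT.eigenvectorBasis.norm_eq_one i
    rw [hPid _ (hnz i hi), h2] at h1
    have h4 : 0 ≤ (q (u i).ofLp).toReal := ENNReal.toReal_nonneg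
    linarith
  refine ⟨U, fun i => if m i = 0 then ∞ else ENNReal.ofReal (m i - 1),
    hT.eigenvectorUnitary.2, fun x => ?_⟩
  simp only [hinner]
  set y : EuclideanSpace ℂ ι := WithLp.toLp 2 x with hy
  by_cases hx : y ∈ W
  · have hc : ∀ i, m i = 0 → inner ℂ (u i) y = (0 : ℂ) := by
      intro i hi
      exact (Submodule.mem_orthogonal' _ _).1 (hzero i hi) y hx
    have h1 : (q (P y).ofLp).toReal + ‖P y‖ ^ 2 = ∑ i, m i * ‖inner ℂ (u i) y‖ ^ 2 := hgsum y
    have h2 : ‖y‖ ^ 2 = ∑ i, ‖inner ℂ (u i) y‖ ^ 2 :=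
      (hT.eigenvectorBasis.sum_sq_norm_inner_right y).symm
    rw [hPid y hx, h2] at h1
    have h3 : (q x).toReal = ∑ i, (m i - 1) * ‖inner ℂ (u i) y‖ ^ 2 := by
      simp only [sub_mul, one_mul, Finset.sum_sub_distrib]
      have : y.ofLp = x := rfl
      rw [this] at h1
      linarith
    have h4 : q x ≠ ∞ := hx
    have hnn : ∀ i, 0 ≤ (m i - 1) * ‖inner ℂ (u i) y‖ ^ 2 := by
      intro i
      by_cases hi : m i = 0
      · rw [hc i hi]; simp
      · exact mul_nonneg (by linarith [hm1 i hi]) (sq_nonneg _)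
    rw [← ENNReal.ofReal_toReal h4, h3, ENNReal.ofReal_sum_of_nonneg fun i _ => hnn i]
    refine Finset.sum_congr rfl fun i _ => ?_
    by_cases hi : m i = 0
    · simp [hc i hi]
    · rw [if_neg hi, ENNReal.ofReal_mul (by linarith [hm1 i hi]),
        ENNReal.ofReal_pow (norm_nonneg _), ofReal_norm]
  · have h1 : q x = ∞ := by
      by_contra hne
      exact hx hne
    rw [h1]
    by_contra hne
    apply hx
    have hc : ∀ i, m i = 0 → inner ℂ (u i) y = (0 : ℂ) := by
      intro i hi
      by_contra hci
      apply hne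
      symm
      rw [ENNReal.sum_eq_top]
      refine ⟨i, Finset.mem_univ i, ?_⟩
      rw [if_pos hi, ENNReal.top_mul]
      simpa using hci
    rw [hexpand y]
    refine Submodule.sum_mem _ fun i _ => ?_
    by_cases hi : m i = 0
    · rw [hc i hi, zero_smul]; exact W.zero_mem
    · exact W.smul_mem _ (hnz i hi)


/-- An infinite-valued predicate on the Hilbert space `ℂ^ι`: a positive operator whose eigenvalues
may be `∞`, given by its quadratic form `x ↦ ⟨x|A|x⟩ = ∑ i, l i * |⟨u i, x⟩|²` for some
orthonormal basis `u` of eigenvectors with eigenvalues `l i ∈ [0, ∞]` (and `0 * ∞ = 0`).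
Two predicates are equal iff their quadratic forms are. -/
@[ext]
structure InfPred (ι : Type*) [Fintype ι] [DecidableEq ι] where
  form : (ι → ℂ) → ℝ≥0∞
  spectral : ∃ U l, IsSpectral form U l

namespace InfPred

section

variable {ι κ : Type*} [Fintype ι] [DecidableEq ι] [Fintype κ] [DecidableEq κ]

theorem isForm (A : InfPred ι) : IsForm A.form := by
  obtain ⟨U, l, h⟩ := A.spectral
  exact h.isForm

/-- A unitary matrix whose columns are eigenvectors. -/
noncomputable def basis (A : InfPred ι) : Matrix ι ι ℂ := A.spectral.choose

/-- The eigenvalues, in `[0, ∞]`. -/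
noncomputable def eig (A : InfPred ι) : ι → ℝ≥0∞ := A.spectral.choose_spec.choose

theorem isSpectral (A : InfPred ι) : IsSpectral A.form A.basis A.eig :=
  A.spectral.choose_spec.choose_spec

/-- `tr(A ρ) = ∑ i, l i * ⟨u i|ρ|u i⟩`. -/
noncomputable def expect (A : InfPred ι) (ρ : Matrix ι ι ℂ) : ℝ≥0∞ :=
  ∑ i, A.eig i * ENNReal.ofReal ((A.basisᴴ * ρ * A.basis) i i).re

/-- The Löwner order. -/
instance : LE (InfPred ι) := ⟨fun A B => ∀ x, A.form x ≤ B.form x⟩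

/-- `r · I`, for `r ∈ [0, ∞]`. -/
noncomputable def scalar (r : ℝ≥0∞) : InfPred ι where
  form x := ∑ i, r * ‖x i‖ₑ ^ 2
  spectral := ⟨1, fun _ => r, one_mem _, fun x => by simp⟩

/-- `r · A`, for `r ∈ [0, ∞]`. -/
noncomputable def smul (r : ℝ≥0∞) (A : InfPred ι) : InfPred ι where
  form x := r * A.form x
  spectral := by
    obtain ⟨U, l, hU, h⟩ := A.spectral
    refine ⟨U, fun i => r * l i, hU, fun x => ?_⟩
    change r * A.form x = _
    rw [h, Finset.mul_sum]
    exact Finset.sum_congr rfl fun i _ => (mul_assoc _ _ _).symm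

/-- `A + B`. -/
noncomputable def add (A B : InfPred ι) : InfPred ι where
  form x := A.form x + B.form x
  spectral := IsForm.exists_spectral
    ⟨fun c x => by rw [A.isForm.homog, B.isForm.homog, mul_add],
      fun x y => by
        rw [add_add_add_comm, A.isForm.parallelogram, B.isForm.parallelogram]; ring⟩

/-- The (possibly infinite) sum `∑ v, A v`, i.e. the supremum of the finite partial sums. -/
noncomputable def sum {V : Type*} (A : V → InfPred ι) : InfPred ι where
  form x := ∑' v, (A v).form x
  spectral := IsForm.exists_spectral
    ⟨fun c x => by simp only [(A _).isForm.homog, ENNReal.tsum_mul_left],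
      fun x y => by
        rw [← ENNReal.tsum_add, ← ENNReal.tsum_add, ← ENNReal.tsum_mul_left]
        exact tsum_congr fun v => (A v).isForm.parallelogram x y⟩

/-- `K† A K`. -/
noncomputable def conj (K : Matrix ι ι ℂ) (A : InfPred ι) : InfPred ι where
  form x := A.form (K *ᵥ x)
  spectral := IsForm.exists_spectral
    ⟨fun c x => by rw [Matrix.mulVec_smul, A.isForm.homog],
      fun x y => by rw [Matrix.mulVec_add, Matrix.mulVec_sub, A.isForm.parallelogram]⟩

/-- `A ⊗ B`: the eigenvectors are the `u i ⊗ w j`, with eigenvalues `l i * m j`. -/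
noncomputable def tensor (A : InfPred ι) (B : InfPred κ) : InfPred (ι × κ) where
  form x := ∑ p : ι × κ,
    A.eig p.1 * B.eig p.2 * ‖((Matrix.kronecker A.basis B.basis)ᴴ *ᵥ x) p‖ₑ ^ 2
  spectral := ⟨Matrix.kronecker A.basis B.basis, fun p => A.eig p.1 * B.eig p.2,
    Matrix.kronecker_mem_unitary A.isSpectral.1 B.isSpectral.1, fun _ => rfl⟩

end

end InfPred

/-! ### Classical-quantum states -/

section States

variable {A A₁ A₂ V ι κ : Type*} [Fintype ι] [DecidableEq ι] [Fintype κ] [DecidableEq κ]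

/-- Partial density operators. -/
structure IsQState (ρ : Matrix ι ι ℂ) : Prop where
  psd : ρ.PosSemidef
  trace_le : ρ.trace.re ≤ 1

/-- The total trace of a family of positive operators. -/
noncomputable def mass (Δ : A → Matrix ι ι ℂ) : ℝ≥0∞ := ∑' a, ENNReal.ofReal (Δ a).trace.re

/-- Classical-quantum states: families of positive operators of total trace at most one. -/
structure IsState (Δ : A → Matrix ι ι ℂ) : Prop where
  psd : ∀ a, (Δ a).PosSemidef
  mass_le : mass Δ ≤ 1

/-- Partial trace over the second factor. -/
def ptrace₂ (M : Matrix (ι × κ) (ι × κ) ℂ) : Matrix ι ι ℂ :=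
  fun i i' => ∑ j, M (i, j) (i', j)

/-- Partial trace over the first factor. -/
def ptrace₁ (M : Matrix (ι × κ) (ι × κ) ℂ) : Matrix κ κ ℂ :=
  fun j j' => ∑ i, M (i, j) (i, j')

/-- `tr₂` of a joint state: the marginal on the first component. -/
noncomputable def tr₂ (Δ : A₁ × A₂ → Matrix (ι × κ) (ι × κ) ℂ) : A₁ → Matrix ι ι ℂ :=
  fun a₁ => ∑' a₂, ptrace₂ (Δ (a₁, a₂))

/-- `tr₁` of a joint state: the marginal on the second component. -/
noncomputable def tr₁ (Δ : A₁ × A₂ → Matrix (ι × κ) (ι × κ) ℂ) : A₂ → Matrix κ κ ℂ :=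
  fun a₂ => ∑' a₁, ptrace₁ (Δ (a₁, a₂))

/-- `Δ : ⟨Δ₁, Δ₂⟩`. -/
structure IsCoupling (Δ : A₁ × A₂ → Matrix (ι × κ) (ι × κ) ℂ)
    (Δ₁ : A₁ → Matrix ι ι ℂ) (Δ₂ : A₂ → Matrix κ κ ℂ) : Prop where
  isState : IsState Δ
  left : tr₂ Δ = Δ₁
  right : tr₁ Δ = Δ₂

/-- The expected value of an infinite-valued assertion in a state. -/
noncomputable def expectation (Δ : A → Matrix ι ι ℂ) (φ : A → InfPred ι) : ℝ≥0∞ :=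
  ∑' a, (φ a).expect (Δ a)

open Classical in
/-- The guarded assertion `b | φ`. -/
noncomputable def guard (b : A → Prop) (φ : A → InfPred ι) : A → InfPred ι :=
  fun a => if b a then φ a else InfPred.scalar ∞

open Classical in
/-- The restriction of a state to a classical condition. -/
noncomputable def restrict (b : A → Prop) (Δ : A → Matrix ι ι ℂ) : A → Matrix ι ι ℂ :=
  fun a => if b a then Δ a else 0

open Classical in
/-- The simple state supported on `a`, with quantum component `ρ`. -/
noncomputable def simple (a : A) (ρ : Matrix ι ι ℂ) : A → Matrix ι ι ℂ :=
  fun a' => if a' = a then ρ else 0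

/-- The split assertion `φ₁ ⊗ id + id ⊗ φ₂`. -/
noncomputable def split (φ₁ : A₁ → InfPred ι) (φ₂ : A₂ → InfPred κ) :
    A₁ × A₂ → InfPred (ι × κ) :=
  fun a => ((φ₁ a.1).tensor (InfPred.scalar 1)).add ((InfPred.scalar 1).tensor (φ₂ a.2))

/-- Bounded assertions. -/
def IsBounded (φ : A → InfPred ι) : Prop := ∃ L : NNReal, ∀ a, φ a ≤ InfPred.scalar L

/-- The duality set `𝒴(φ)`. -/
def dualitySet (φ : A₁ × A₂ → InfPred (ι × κ)) :
    Set (ℕ × (A₁ → InfPred ι) × (A₂ → InfPred κ)) :=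
  {t | IsBounded t.2.1 ∧ IsBounded t.2.2 ∧
    ∀ a, split t.2.1 t.2.2 a ≤ (φ a).add (InfPred.scalar t.1)}

/-- A quantum measurement with outcomes in `V`. -/
structure Measurement (V ι : Type*) [Fintype ι] [DecidableEq ι] where
  op : V → Matrix ι ι ℂ
  complete : HasSum (fun v => (op v)ᴴ * op v) 1

/-- `Eval(μ)`, for a discrete distribution `μ`. -/
noncomputable def evalDist (μ : PMF V) (ρ : Matrix ι ι ℂ) : V → Matrix ι ι ℂ :=
  fun v => ((μ v).toReal : ℂ) • ρ

/-- `Eval(M)`, for measurement operators `M v`. -/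
def evalMeas (M : V → Matrix ι ι ℂ) (ρ : Matrix ι ι ℂ) : V → Matrix ι ι ℂ :=
  fun v => M v * ρ * (M v)ᴴ

/-- The coupling condition `⊨ g₁ ≈ g₂ : ψ ⇒ Φ`. -/
def CouplingCondition {S : Type*} (g₁ : Matrix ι ι ℂ → A₁ → Matrix ι ι ℂ)
    (g₂ : Matrix κ κ ℂ → A₂ → Matrix κ κ ℂ) (ψ : S → InfPred (ι × κ))
    (Φ : A₁ × A₂ → S → InfPred (ι × κ)) : Prop :=
  ∀ (σ : S) (ρ : Matrix (ι × κ) (ι × κ) ℂ), IsQState ρ →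
    ∃ Δ : A₁ × A₂ → Matrix (ι × κ) (ι × κ) ℂ,
      IsCoupling Δ (g₁ (ptrace₂ ρ)) (g₂ (ptrace₁ ρ)) ∧
      expectation Δ (fun p => Φ p σ) ≤ (ψ σ).expect ρ

end States

/-! ### Programs -/

/-- Classical memories. -/
abbrev Mem (C Val : Type*) := C → Val

/-- The computational basis of the Hilbert space of all quantum variables; the variable `q` has
the Hilbert space `ℂ^(d q)`. -/
abbrev QIdx {Q : Type*} (d : Q → ℕ) := ∀ q, Fin (d q)

/-- The computational basis of the Hilbert space of a register, i.e. a set of quantum variables. -/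
abbrev RIdx {Q : Type*} (d : Q → ℕ) (S : Finset Q) := ∀ q : S, Fin (d q)

open Classical in
/-- The memory update `σ[v/x]`. -/
noncomputable def upd {C Val : Type*} (σ : Mem C Val) (x : C) (v : Val) : Mem C Val :=
  Function.update σ x v

/-- Commands of `cqWhile`. Classical expressions and guards are arbitrary functions of the
classical memory, as are the pure states (unit vectors) used in quantum initialization. -/
inductive Cmd (C Val : Type*) {Q : Type*} [DecidableEq Q] (d : Q → ℕ) where
  | skip
  | abort
  | assign (x : C) (e : Mem C Val → Val)
  | sample (x : C) (μ : PMF Val)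
  | init (S : Finset Q) (v : Mem C Val → {v : RIdx d S → ℂ // star v ⬝ᵥ v = 1})
  | apply (S : Finset Q) (U : Matrix.unitaryGroup (RIdx d S) ℂ)
  | measure (x : C) (S : Finset Q) (M : Measurement Val (RIdx d S))
  | seq (c c' : Cmd C Val d)
  | ite (b : Mem C Val → Prop) (c c' : Cmd C Val d)
  | loop (b : Mem C Val → Prop) (c : Cmd C Val d)

section Programs

variable {C Val Q : Type*} [Fintype Q] [DecidableEq Q] {d : Q → ℕ}

/-- The operator `K_S`, i.e. `K` on the register `S` and the identity on the other variables. -/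
def extend (S : Finset Q) (K : Matrix (RIdx d S) (RIdx d S) ℂ) : Matrix (QIdx d) (QIdx d) ℂ :=
  fun s t => if ∀ q, q ∉ S → s q = t q then K (fun q => s q) (fun q => t q) else 0

/-- The operator `|v⟩⟨i|` on the register `S`. -/
def initOp (S : Finset Q) (v : RIdx d S → ℂ) (i : RIdx d S) : Matrix (QIdx d) (QIdx d) ℂ :=
  extend S (Matrix.vecMulVec v (Pi.single i 1))

/-- The linear extension to all states of a function on simple states. -/
noncomputable def lift (f : Mem C Val → Matrix (QIdx d) (QIdx d) ℂ →
      Mem C Val → Matrix (QIdx d) (QIdx d) ℂ)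
    (Δ : Mem C Val → Matrix (QIdx d) (QIdx d) ℂ) : Mem C Val → Matrix (QIdx d) (QIdx d) ℂ :=
  fun τ => ∑' σ, f σ (Δ σ) τ

/-- Denotational semantics. On classical-quantum states all the series converge absolutely. -/
noncomputable def Cmd.den : Cmd C Val d →
    (Mem C Val → Matrix (QIdx d) (QIdx d) ℂ) → Mem C Val → Matrix (QIdx d) (QIdx d) ℂ
  | .skip => fun Δ => Δ
  | .abort => fun _ => 0
  | .assign x e => lift fun σ ρ => simple (upd σ x (e σ)) ρ
  | .sample x μ => lift fun σ ρ τ => ∑' v, simple (upd σ x v) (evalDist μ ρ v) τ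
  | .init S v => lift fun σ ρ => simple σ (∑ i, initOp S (v σ) i * ρ * (initOp S (v σ) i)ᴴ)
  | .apply S U => lift fun σ ρ => simple σ (extend S U * ρ * (extend S U)ᴴ)
  | .measure x S M => lift fun σ ρ τ =>
      ∑' v, simple (upd σ x v) (evalMeas (fun v => extend S (M.op v)) ρ v) τ
  | .seq c c' => fun Δ => c'.den (c.den Δ)
  | .ite b c c' => fun Δ => c.den (restrict b Δ) + c'.den (restrict (fun σ => ¬ b σ) Δ)
  | .loop b c => fun Δ τ =>
      ∑' n : ℕ, restrict (fun σ => ¬ b σ) ((fun Δ' => c.den (restrict b Δ'))^[n] Δ) τ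

/-- Almost sure termination. -/
def Cmd.AST (c : Cmd C Val d) : Prop := ∀ Δ, IsState Δ → mass (c.den Δ) = mass Δ

/-- Hereditary almost sure termination: all subprograms terminate almost surely. -/
def Cmd.HAST : Cmd C Val d → Prop
  | .seq c c' => (Cmd.seq c c').AST ∧ c.HAST ∧ c'.HAST
  | .ite b c c' => (Cmd.ite b c c').AST ∧ c.HAST ∧ c'.HAST
  | .loop b c => (Cmd.loop b c).AST ∧ c.HAST
  | c => c.AST

/-- The classical variable `x` is assigned to in the command. -/
def Cmd.Modifies (x : C) : Cmd C Val d → Prop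
  | .assign y _ => x = y
  | .sample y _ => x = y
  | .measure y _ _ => x = y
  | .seq c c' => c.Modifies x ∨ c'.Modifies x
  | .ite _ c c' => c.Modifies x ∨ c'.Modifies x
  | .loop _ c => c.Modifies x
  | _ => False

/-- The identification of `skip; c` and `c; skip` with `c`. -/
inductive Cmd.SkipEq : Cmd C Val d → Cmd C Val d → Prop
  | refl (c) : SkipEq c c
  | symm {c c'} : SkipEq c c' → SkipEq c' c
  | trans {c c' c''} : SkipEq c c' → SkipEq c' c'' → SkipEq c c''
  | skip_seq (c) : SkipEq (.seq .skip c) c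
  | seq_skip (c) : SkipEq (.seq c .skip) c
  | seq {c₁ c₁' c₂ c₂'} : SkipEq c₁ c₁' → SkipEq c₂ c₂' → SkipEq (.seq c₁ c₂) (.seq c₁' c₂')
  | ite (b) {c₁ c₁' c₂ c₂'} :
      SkipEq c₁ c₁' → SkipEq c₂ c₂' → SkipEq (.ite b c₁ c₂) (.ite b c₁' c₂')
  | loop (b) {c c'} : SkipEq c c' → SkipEq (.loop b c) (.loop b c')

end Programs

/-! ### The relational logic -/

section Logic

variable {C₁ C₂ Val Q₁ Q₂ : Type*} [Fintype Q₁] [DecidableEq Q₁] [Fintype Q₂] [DecidableEq Q₂]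
  {d₁ : Q₁ → ℕ} {d₂ : Q₂ → ℕ}

/-- Joint classical memories. -/
abbrev RMem (C₁ C₂ Val : Type*) := Mem C₁ Val × Mem C₂ Val

/-- Infinite-valued relational assertions. -/
abbrev RAssn (C₁ C₂ Val : Type*) {Q₁ Q₂ : Type*} [Fintype Q₁] [DecidableEq Q₁]
    [Fintype Q₂] [DecidableEq Q₂] (d₁ : Q₁ → ℕ) (d₂ : Q₂ → ℕ) :=
  RMem C₁ C₂ Val → InfPred (QIdx d₁ × QIdx d₂)

/-- An operator on the left quantum variables, as an operator on the joint space. -/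
def onLeft (K : Matrix (QIdx d₁) (QIdx d₁) ℂ) :
    Matrix (QIdx d₁ × QIdx d₂) (QIdx d₁ × QIdx d₂) ℂ := Matrix.kronecker K 1

/-- An operator on the right quantum variables, as an operator on the joint space. -/
def onRight (K : Matrix (QIdx d₂) (QIdx d₂) ℂ) :
    Matrix (QIdx d₁ × QIdx d₂) (QIdx d₁ × QIdx d₂) ℂ := Matrix.kronecker 1 K

/-- `⊨ {φ} c₁ ~ c₂ {ψ}`. -/
def Valid (φ : RAssn C₁ C₂ Val d₁ d₂) (c₁ : Cmd C₁ Val d₁) (c₂ : Cmd C₂ Val d₂)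
    (ψ : RAssn C₁ C₂ Val d₁ d₂) : Prop :=
  ∀ Δ : RMem C₁ C₂ Val → Matrix (QIdx d₁ × QIdx d₂) (QIdx d₁ × QIdx d₂) ℂ, IsState Δ →
    ∃ Δ' : RMem C₁ C₂ Val → Matrix (QIdx d₁ × QIdx d₂) (QIdx d₁ × QIdx d₂) ℂ,
      IsCoupling Δ' (c₁.den (tr₂ Δ)) (c₂.den (tr₁ Δ)) ∧ expectation Δ' ψ ≤ expectation Δ φ

/-- The infimum of the expected value of an assertion over all couplings of two states. -/
noncomputable def infExpectation (φ : RAssn C₁ C₂ Val d₁ d₂)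
    (Δ₁ : Mem C₁ Val → Matrix (QIdx d₁) (QIdx d₁) ℂ)
    (Δ₂ : Mem C₂ Val → Matrix (QIdx d₂) (QIdx d₂) ℂ) : ℝ≥0∞ :=
  ⨅ Δ' ∈ {Δ' | IsCoupling Δ' Δ₁ Δ₂}, expectation Δ' φ

/-- The semantic side condition of the rule of consequence. -/
def Entails (ψ' φ' ψ φ : RAssn C₁ C₂ Val d₁ d₂) : Prop :=
  ∀ (Δ : RMem C₁ C₂ Val → Matrix (QIdx d₁ × QIdx d₂) (QIdx d₁ × QIdx d₂) ℂ)
    (Δ₁ : Mem C₁ Val → Matrix (QIdx d₁) (QIdx d₁) ℂ)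
    (Δ₂ : Mem C₂ Val → Matrix (QIdx d₂) (QIdx d₂) ℂ), IsState Δ → IsState Δ₁ → IsState Δ₂ →
    infExpectation φ' Δ₁ Δ₂ ≤ expectation Δ ψ' → infExpectation φ Δ₁ Δ₂ ≤ expectation Δ ψ

/-- `full` is the whole proof system; `oneSided` is its fragment that consists of the one-sided
rules, the rules for `skip` and sequential composition, and the rule of consequence. -/
inductive System
  | full
  | oneSided

/-- Derivability `⊢ {ψ} c₁ ~ c₂ {φ}` in `cqOTL` (or in its one-sided fragment). -/
inductive Derivable : System → RAssn C₁ C₂ Val d₁ d₂ → Cmd C₁ Val d₁ → Cmd C₂ Val d₂ →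
    RAssn C₁ C₂ Val d₁ d₂ → Prop
  -- Basic rules
  | skip {s} (ψ) : Derivable s ψ .skip .skip ψ
  | seq {s ψ ξ φ c₁ c₂ c₁' c₂'} : Derivable s ψ c₁ c₂ ξ → Derivable s ξ c₁' c₂' φ →
      Derivable s ψ (.seq c₁ c₁') (.seq c₂ c₂') φ
  | skipEq {s ψ φ c₁ c₂ c₁' c₂'} : c₁.SkipEq c₁' → c₂.SkipEq c₂' →
      Derivable s ψ c₁ c₂ φ → Derivable s ψ c₁' c₂' φ
  | conseq {s ψ' φ' ψ φ c₁ c₂} : Derivable s ψ' c₁ c₂ φ' → Entails ψ' φ' ψ φ →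
      Derivable s ψ c₁ c₂ φ
  -- One-sided rules, left
  | assignL {s} (x e ψ) :
      Derivable s (fun σ => ψ (upd σ.1 x (e σ.1), σ.2)) (.assign x e) .skip ψ
  | ifL {s b₁ ψ φ c₁ c₁' c₂} : Derivable s (guard (fun σ => b₁ σ.1) ψ) c₁ c₂ φ →
      Derivable s (guard (fun σ => ¬ b₁ σ.1) ψ) c₁' c₂ φ →
      Derivable s ψ (.ite b₁ c₁ c₁') c₂ φ
  | whileL {s b₁ ψ c₁} : Derivable s (guard (fun σ => b₁ σ.1) ψ) c₁ .skip ψ →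
      (Cmd.loop b₁ c₁).AST →
      Derivable s ψ (.loop b₁ c₁) .skip (guard (fun σ => ¬ b₁ σ.1) ψ)
  | sampleL {s} (x μ ψ) :
      Derivable s (fun σ => .sum fun v => .smul (μ v) (ψ (upd σ.1 x v, σ.2)))
        (.sample x μ) .skip ψ
  | initL {s} (S v ψ) :
      Derivable s (fun σ => .sum fun i => .conj (onLeft (initOp S (v σ.1) i)) (ψ σ))
        (.init S v) .skip ψ
  | applyL {s} (S) (U : Matrix.unitaryGroup (RIdx d₁ S) ℂ) (ψ) :
      Derivable s (fun σ => .conj (onLeft (extend S U)) (ψ σ)) (.apply S U) .skip ψ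
  | measureL {s} (x S M ψ) :
      Derivable s
        (fun σ => .sum fun v => .conj (onLeft (extend S (M.op v))) (ψ (upd σ.1 x v, σ.2)))
        (.measure x S M) .skip ψ
  -- One-sided rules, right
  | assignR {s} (x e ψ) :
      Derivable s (fun σ => ψ (σ.1, upd σ.2 x (e σ.2))) .skip (.assign x e) ψ
  | ifR {s b₂ ψ φ c₁ c₂ c₂'} : Derivable s (guard (fun σ => b₂ σ.2) ψ) c₁ c₂ φ →
      Derivable s (guard (fun σ => ¬ b₂ σ.2) ψ) c₁ c₂' φ →
      Derivable s ψ c₁ (.ite b₂ c₂ c₂') φ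
  | whileR {s b₂ ψ c₂} : Derivable s (guard (fun σ => b₂ σ.2) ψ) .skip c₂ ψ →
      (Cmd.loop b₂ c₂).AST →
      Derivable s ψ .skip (.loop b₂ c₂) (guard (fun σ => ¬ b₂ σ.2) ψ)
  | sampleR {s} (x μ ψ) :
      Derivable s (fun σ => .sum fun v => .smul (μ v) (ψ (σ.1, upd σ.2 x v)))
        .skip (.sample x μ) ψ
  | initR {s} (S v ψ) :
      Derivable s (fun σ => .sum fun i => .conj (onRight (initOp S (v σ.2) i)) (ψ σ))
        .skip (.init S v) ψ
  | applyR {s} (S) (U : Matrix.unitaryGroup (RIdx d₂ S) ℂ) (ψ) :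
      Derivable s (fun σ => .conj (onRight (extend S U)) (ψ σ)) .skip (.apply S U) ψ
  | measureR {s} (x S M ψ) :
      Derivable s
        (fun σ => .sum fun v => .conj (onRight (extend S (M.op v))) (ψ (σ.1, upd σ.2 x v)))
        .skip (.measure x S M) ψ
  -- Two-sided rules
  | assign (x₁ e₁ x₂ e₂ ψ) :
      Derivable .full (fun σ => ψ (upd σ.1 x₁ (e₁ σ.1), upd σ.2 x₂ (e₂ σ.2)))
        (.assign x₁ e₁) (.assign x₂ e₂) ψ
  | ite {b₁ b₂ ψ φ c₁ c₂ c₁' c₂'} :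
      Derivable .full (guard (fun σ => b₁ σ.1 ∧ b₂ σ.2) ψ) c₁ c₂ φ →
      Derivable .full (guard (fun σ => ¬ b₁ σ.1 ∧ ¬ b₂ σ.2) ψ) c₁' c₂' φ →
      Derivable .full (guard (fun σ => b₁ σ.1 ↔ b₂ σ.2) ψ)
        (.ite b₁ c₁ c₁') (.ite b₂ c₂ c₂') φ
  | loop {b₁ b₂ ψ c₁ c₂} :
      Derivable .full (guard (fun σ => b₁ σ.1 ∧ b₂ σ.2) ψ) c₁ c₂
        (guard (fun σ => b₁ σ.1 ↔ b₂ σ.2) ψ) →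
      Derivable .full (guard (fun σ => b₁ σ.1 ↔ b₂ σ.2) ψ) (.loop b₁ c₁) (.loop b₂ c₂)
        (guard (fun σ => ¬ b₁ σ.1 ∧ ¬ b₂ σ.2) ψ)
  | sample {x₁ μ₁ x₂ μ₂ ψ φ} :
      CouplingCondition (evalDist μ₁) (evalDist μ₂) ψ
        (fun p σ => φ (upd σ.1 x₁ p.1, upd σ.2 x₂ p.2)) →
      Derivable .full ψ (.sample x₁ μ₁) (.sample x₂ μ₂) φ
  | measure {x₁ S₁ M₁ x₂ S₂ M₂ ψ φ} :
      CouplingCondition (evalMeas fun v => extend S₁ (M₁.op v))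
        (evalMeas fun v => extend S₂ (M₂.op v)) ψ
        (fun p σ => φ (upd σ.1 x₁ p.1, upd σ.2 x₂ p.2)) →
      Derivable .full ψ (.measure x₁ S₁ M₁) (.measure x₂ S₂ M₂) φ
  | measureSample {x₁ S₁ M₁ x₂ μ₂ ψ φ} :
      CouplingCondition (evalMeas fun v => extend S₁ (M₁.op v)) (evalDist μ₂) ψ
        (fun p σ => φ (upd σ.1 x₁ p.1, upd σ.2 x₂ p.2)) →
      Derivable .full ψ (.measure x₁ S₁ M₁) (.sample x₂ μ₂) φ
  -- Structural rules
  | nmod {x₁ ψ φ c₁ c₂} : ¬ c₁.Modifies x₁ →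
      (∀ v, Derivable .full (guard (fun σ => σ.1 x₁ = v) ψ) c₁ c₂
        (fun σ => φ (upd σ.1 x₁ v, σ.2))) →
      Derivable .full ψ c₁ c₂ φ
  | unboundedDuality {ψ φ c₁ c₂} : c₁.AST → c₂.AST →
      (∀ n φ₁ φ₂, (n, φ₁, φ₂) ∈ dualitySet φ →
        Derivable .full (fun σ => (ψ σ).add (.scalar (n : ℝ≥0∞))) c₁ c₂ (split φ₁ φ₂)) →
      Derivable .full ψ c₁ c₂ φ
  | limit {ψ φ c₁ c₂} (φs : ℕ → RAssn C₁ C₂ Val d₁ d₂) :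
      (∀ n, Derivable .full ψ c₁ c₂ (φs n)) →
      (∀ σ x, Filter.Tendsto (fun n => (φs n σ).form x) Filter.atTop (nhds ((φ σ).form x))) →
      Derivable .full ψ c₁ c₂ φ

end Logic

end CqOTL

/-!
Two observations make split postconditions easy.

First, the expected value of `φ₁ ⊗ id + id ⊗ φ₂` in a joint state is the sum of the expected values
of `φ₁` and `φ₂` in its two marginals (`CqOTL.expectation_split`). Hence all couplings of two given
states agree on a split assertion, and validity involves only the separate output states of the programs.

Second, each program `c` has a weakest precondition `c.wp φ` for a one-program assertion `φ`
(`CqOTL.Cmd.wp`), and it is dual to the semantics: `𝔼_{⟦c⟧Δ}[φ] = 𝔼_Δ[c.wp φ]`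
(`CqOTL.Cmd.isDual`). Together the two facts show that a valid precondition `ψ` dominates
`c₁.wp φ₁ ⊗ id + id ⊗ c₂.wp φ₂` in expectation (`CqOTL.expectation_split_wp_le`), so by the rule of
consequence it suffices to derive the judgment with this precondition. By sequencing with `skip`,
this reduces to one program at a time, which is an induction on the program
(`CqOTL.derivable_wp_left`, `CqOTL.derivable_wp_right`). The axioms produce exactly the split
preconditions because sampling and Kraus families preserve the total weight of the untouched side,
and for a loop the split of its weakest precondition is an invariant, by the fixed-point equation
`CqOTL.Cmd.wp_loop`.

The analytic input is that the expected value of a predicate depends only on its quadratic form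
(`CqOTL.InfPred.expect_mul_conjTranspose`) and is countably additive in the state
(`CqOTL.InfPred.expect_tsum`) and in the predicate
(`CqOTL.InfPred.expect_sum`). Since `c.wp` is countably additive too, the weakest precondition of a loop can be taken to be a series over the
number of iterations.
-/

set_option linter.unusedSectionVars false

namespace CqOTL

/-! ### Expected values of quadratic forms -/

section Forms

variable {V K ι κ : Type*} [Fintype ι] [DecidableEq ι] [Fintype κ] [DecidableEq κ] [Fintype K]

theorem ofReal_norm_sq (z : ℂ) : ENNReal.ofReal (‖z‖ ^ 2) = ‖z‖ₑ ^ 2 := by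
  rw [ENNReal.ofReal_pow (norm_nonneg _), ofReal_norm]

theorem re_mul_conjTranspose_apply_self (B : Matrix ι K ℂ) (i : ι) :
    ((B * Bᴴ) i i).re = ∑ k, ‖B i k‖ ^ 2 := by
  simp [Matrix.mul_apply, Complex.mul_conj, Complex.normSq_eq_norm_sq, -Complex.ofReal_pow]

theorem ofReal_re_mul_conjTranspose (B : Matrix ι K ℂ) (i : ι) :
    ENNReal.ofReal ((B * Bᴴ) i i).re = ∑ k, ‖B i k‖ₑ ^ 2 := by
  rw [re_mul_conjTranspose_apply_self, ENNReal.ofReal_sum_of_nonneg fun _ _ => sq_nonneg _]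
  simp only [ofReal_norm_sq]

theorem ofReal_trace_mul_conjTranspose (B : Matrix ι K ℂ) :
    ENNReal.ofReal (B * Bᴴ).trace.re = ∑ k, ∑ i, ‖B i k‖ₑ ^ 2 := by
  rw [Finset.sum_comm]
  simp only [Matrix.trace, Matrix.diag_apply, Complex.re_sum]
  rw [ENNReal.ofReal_sum_of_nonneg fun i _ => by
    rw [re_mul_conjTranspose_apply_self]; positivity]
  exact Finset.sum_congr rfl fun i _ => ofReal_re_mul_conjTranspose B i

theorem exists_eq_mul_conjTranspose {ρ : Matrix ι ι ℂ} (h : ρ.PosSemidef) :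
    ∃ B : Matrix ι ι ℂ, ρ = B * Bᴴ := by
  open scoped MatrixOrder in
  obtain ⟨B, hB⟩ := CStarAlgebra.nonneg_iff_eq_star_mul_self.mp h.nonneg
  exact ⟨Bᴴ, by simpa [Matrix.star_eq_conjTranspose] using hB⟩

/-- The expected value depends on the predicate only through its quadratic form: it is the sum of
the values of the form on the columns of any `B` with `ρ = B * Bᴴ`. -/
theorem InfPred.expect_mul_conjTranspose (A : InfPred ι) (B : Matrix ι K ℂ) :
    A.expect (B * Bᴴ) = ∑ k, A.form (B.col k) := by
  have h1 : A.basisᴴ * (B * Bᴴ) * A.basis = (A.basisᴴ * B) * (A.basisᴴ * B)ᴴ := by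
    simp [Matrix.conjTranspose_mul, Matrix.mul_assoc]
  simp only [InfPred.expect, h1, ofReal_re_mul_conjTranspose, Finset.mul_sum, A.isSpectral.2]
  rw [Finset.sum_comm]
  rfl

theorem InfPred.expect_mono {A B : InfPred ι} (h : A ≤ B) {ρ : Matrix ι ι ℂ}
    (hρ : ρ.PosSemidef) : A.expect ρ ≤ B.expect ρ := by
  obtain ⟨C, rfl⟩ := exists_eq_mul_conjTranspose hρ
  simp only [InfPred.expect_mul_conjTranspose]
  exact Finset.sum_le_sum fun k _ => h _

theorem InfPred.expect_sum (A : V → InfPred ι) {ρ : Matrix ι ι ℂ} (hρ : ρ.PosSemidef) :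
    (InfPred.sum A).expect ρ = ∑' v, (A v).expect ρ := by
  obtain ⟨C, rfl⟩ := exists_eq_mul_conjTranspose hρ
  simp only [InfPred.expect_mul_conjTranspose, InfPred.sum]
  exact (Summable.tsum_finsetSum fun _ _ => ENNReal.summable).symm

theorem InfPred.expect_smul (r : ℝ≥0∞) (A : InfPred ι) {ρ : Matrix ι ι ℂ} (hρ : ρ.PosSemidef) :
    (InfPred.smul r A).expect ρ = r * A.expect ρ := by
  obtain ⟨C, rfl⟩ := exists_eq_mul_conjTranspose hρ
  simp only [InfPred.expect_mul_conjTranspose, InfPred.smul, Finset.mul_sum]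

theorem InfPred.expect_conj (M : Matrix ι ι ℂ) (A : InfPred ι) {ρ : Matrix ι ι ℂ}
    (hρ : ρ.PosSemidef) : (InfPred.conj M A).expect ρ = A.expect (M * ρ * Mᴴ) := by
  obtain ⟨C, rfl⟩ := exists_eq_mul_conjTranspose hρ
  rw [show M * (C * Cᴴ) * Mᴴ = (M * C) * (M * C)ᴴ by
    simp [Matrix.conjTranspose_mul, Matrix.mul_assoc]]
  simp only [InfPred.expect_mul_conjTranspose, InfPred.conj]
  rfl

theorem InfPred.expect_scalar_zero {ρ : Matrix ι ι ℂ} (hρ : ρ.PosSemidef) :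
    (InfPred.scalar 0).expect ρ = 0 := by
  obtain ⟨C, rfl⟩ := exists_eq_mul_conjTranspose hρ
  simp [InfPred.expect_mul_conjTranspose, InfPred.scalar]

theorem InfPred.expect_scalar_one {ρ : Matrix ι ι ℂ} (hρ : ρ.PosSemidef) :
    (InfPred.scalar 1).expect ρ = ENNReal.ofReal ρ.trace.re := by
  obtain ⟨C, rfl⟩ := exists_eq_mul_conjTranspose hρ
  simp [InfPred.expect_mul_conjTranspose, InfPred.scalar, ofReal_trace_mul_conjTranspose]

theorem InfPred.expect_zero (A : InfPred ι) : A.expect 0 = 0 := by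
  simp [InfPred.expect]

theorem InfPred.expect_smul_matrix (A : InfPred ι) {r : ℝ} (hr : 0 ≤ r) (ρ : Matrix ι ι ℂ) :
    A.expect ((r : ℂ) • ρ) = ENNReal.ofReal r * A.expect ρ := by
  simp only [InfPred.expect, Finset.mul_sum]
  refine Finset.sum_congr rfl fun i _ => ?_
  rw [Matrix.mul_smul, Matrix.smul_mul, Matrix.smul_apply, smul_eq_mul, Complex.re_ofReal_mul,
    ENNReal.ofReal_mul hr]
  ring

theorem InfPred.le_scalar_top (A : InfPred ι) : A ≤ InfPred.scalar ∞ := by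
  intro x
  by_cases hx : x = 0
  · subst hx
    simp [A.isSpectral.2]
  · obtain ⟨i, hi⟩ := Function.ne_iff.mp hx
    have : (InfPred.scalar ∞ : InfPred ι).form x = ∞ := by
      change ∑ i, ∞ * ‖x i‖ₑ ^ 2 = ∞
      rw [ENNReal.sum_eq_top]
      refine ⟨i, Finset.mem_univ i, ENNReal.top_mul ?_⟩
      simpa using hi
    rw [this]
    exact le_top

/-- The entries of a positive semidefinite matrix are bounded by its trace. -/
theorem norm_apply_le_trace {ρ : Matrix ι ι ℂ} (hρ : ρ.PosSemidef) (i j : ι) :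
    ‖ρ i j‖ ≤ ρ.trace.re := by
  obtain ⟨B, rfl⟩ := exists_eq_mul_conjTranspose hρ
  have hT : (B * Bᴴ).trace.re = ∑ i, ∑ k, ‖B i k‖ ^ 2 := by
    simp only [Matrix.trace, Matrix.diag_apply, Complex.re_sum, re_mul_conjTranspose_apply_self]
  have hle : ∀ i, ∑ k, ‖B i k‖ ^ 2 ≤ ∑ i, ∑ k, ‖B i k‖ ^ 2 := fun i =>
    Finset.single_le_sum (f := fun i => ∑ k, ‖B i k‖ ^ 2) (fun _ _ => by positivity)
      (Finset.mem_univ i)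
  have h1 : ‖(B * Bᴴ) i j‖ ≤ ∑ k, (‖B i k‖ ^ 2 + ‖B j k‖ ^ 2) / 2 := by
    rw [Matrix.mul_apply]
    refine (norm_sum_le _ _).trans (Finset.sum_le_sum fun k _ => ?_)
    rw [norm_mul, Matrix.conjTranspose_apply, norm_star]
    nlinarith [sq_nonneg (‖B i k‖ - ‖B j k‖)]
  rw [← Finset.sum_div, Finset.sum_add_distrib] at h1
  rw [hT]
  linarith [hle i, hle j]

theorem trace_re_nonneg {ρ : Matrix ι ι ℂ} (hρ : ρ.PosSemidef) : 0 ≤ ρ.trace.re :=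
  (Complex.le_def.mp hρ.trace_nonneg).1

theorem summable_of_trace {ρ : V → Matrix ι ι ℂ} (hρ : ∀ v, (ρ v).PosSemidef)
    (h : ∑' v, ENNReal.ofReal (ρ v).trace.re ≠ ∞) : Summable ρ := by
  have h1 : Summable fun v => (ρ v).trace.re := by
    have := ENNReal.summable_toReal h
    simpa only [ENNReal.toReal_ofReal (trace_re_nonneg (hρ _))] using this
  refine Pi.summable.mpr fun i => Pi.summable.mpr fun j => ?_
  exact Summable.of_norm_bounded h1 fun v => norm_apply_le_trace (hρ v) i j

/-- No summability is needed: a divergent series has the value `0`. -/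
theorem posSemidef_tsum {ρ : V → Matrix ι ι ℂ} (hρ : ∀ v, (ρ v).PosSemidef) :
    (∑' v, ρ v).PosSemidef := by
  by_cases hs : Summable ρ
  · open scoped MatrixOrder in
    have hc : IsClosed {M : Matrix ι ι ℂ | M.PosSemidef} := by
      have : {M : Matrix ι ι ℂ | M.PosSemidef}
          = {M | Mᴴ = M} ∩ ⋂ x : ι → ℂ, {M | 0 ≤ star x ⬝ᵥ (M *ᵥ x)} := by
        ext M
        simp [Matrix.posSemidef_iff_dotProduct_mulVec, Matrix.IsHermitian]
      rw [this]
      refine IsClosed.inter (isClosed_eq (by fun_prop) continuous_id)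
        (isClosed_iInter fun x => isClosed_le continuous_const ?_)
      fun_prop
    exact hc.mem_of_tendsto hs.hasSum
      (Filter.Eventually.of_forall fun s => Matrix.posSemidef_sum s fun v _ => hρ v)
  · rw [tsum_eq_zero_of_not_summable hs]
    exact Matrix.PosSemidef.zero

/-- The expected value is countably additive in the state. -/
theorem InfPred.expect_tsum (A : InfPred ι) {ρ : V → Matrix ι ι ℂ}
    (hρ : ∀ v, (ρ v).PosSemidef) (h : ∑' v, ENNReal.ofReal (ρ v).trace.re ≠ ∞) :
    A.expect (∑' v, ρ v) = ∑' v, A.expect (ρ v) := by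
  have hs := (summable_of_trace hρ h).hasSum
  simp only [InfPred.expect]
  rw [Summable.tsum_finsetSum fun _ _ => ENNReal.summable]
  refine Finset.sum_congr rfl fun i _ => ?_
  rw [ENNReal.tsum_mul_left]
  congr 1
  have h1 := (hs.mul_left A.basisᴴ).mul_right A.basis
  have h2 := Complex.hasSum_re (Pi.hasSum.mp (Pi.hasSum.mp h1 i) i)
  rw [← h2.tsum_eq]
  refine ENNReal.ofReal_tsum_of_nonneg (fun v => ?_) h2.summable
  have := ((hρ v).conjTranspose_mul_mul_same A.basis).diag_nonneg (i := i)
  exact (Complex.le_def.mp this).1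

end Forms

/-! ### Families of operators, and their expected values -/

section Families

variable {V A A₁ A₂ ι κ : Type*} [Fintype ι] [DecidableEq ι] [Fintype κ] [DecidableEq κ]

theorem mass_eq_expectation {Δ : A → Matrix ι ι ℂ} (h : ∀ a, (Δ a).PosSemidef) :
    mass Δ = expectation Δ fun _ => InfPred.scalar 1 :=
  tsum_congr fun a => (InfPred.expect_scalar_one (h a)).symm

theorem le_mass (Δ : A → Matrix ι ι ℂ) (a : A) : ENNReal.ofReal (Δ a).trace.re ≤ mass Δ :=
  ENNReal.le_tsum a

theorem expectation_mono {φ φ' : A → InfPred ι} (h : ∀ a, φ a ≤ φ' a) {Δ : A → Matrix ι ι ℂ}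
    (hΔ : ∀ a, (Δ a).PosSemidef) : expectation Δ φ ≤ expectation Δ φ' :=
  ENNReal.tsum_le_tsum fun a => InfPred.expect_mono (h a) (hΔ a)

/-- Expectations are countably additive in the state. -/
theorem expectation_tsum {ρ : V → A → Matrix ι ι ℂ} (hρ : ∀ v a, (ρ v a).PosSemidef)
    (h : ∑' v, mass (ρ v) ≠ ∞) (φ : A → InfPred ι) :
    expectation (fun a => ∑' v, ρ v a) φ = ∑' v, expectation (ρ v) φ := by
  simp only [expectation]
  rw [ENNReal.tsum_comm]
  refine tsum_congr fun a => (φ a).expect_tsum (fun v => hρ v a) ?_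
  exact ne_top_of_le_ne_top h (ENNReal.tsum_le_tsum fun v => le_mass _ _)

theorem mass_tsum {ρ : V → A → Matrix ι ι ℂ} (hρ : ∀ v a, (ρ v a).PosSemidef)
    (h : ∑' v, mass (ρ v) ≠ ∞) : mass (fun a => ∑' v, ρ v a) = ∑' v, mass (ρ v) := by
  rw [mass_eq_expectation fun a => posSemidef_tsum fun v => hρ v a, expectation_tsum hρ h]
  exact tsum_congr fun v => (mass_eq_expectation (hρ v)).symm

theorem posSemidef_simple (a : A) {ρ : Matrix ι ι ℂ} (hρ : ρ.PosSemidef) (a' : A) :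
    (simple a ρ a').PosSemidef := by
  unfold simple
  split_ifs
  · exact hρ
  · exact Matrix.PosSemidef.zero

theorem expectation_simple (a : A) (ρ : Matrix ι ι ℂ) (φ : A → InfPred ι) :
    expectation (simple a ρ) φ = (φ a).expect ρ := by
  unfold expectation
  rw [tsum_eq_single a fun a' ha => by simp [simple, ha, InfPred.expect_zero]]
  simp [simple]

theorem mass_simple (a : A) (ρ : Matrix ι ι ℂ) :
    mass (simple a ρ) = ENNReal.ofReal ρ.trace.re := by
  unfold mass
  rw [tsum_eq_single a fun a' ha => by simp [simple, ha]]
  simp [simple]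

theorem posSemidef_restrict (b : A → Prop) {Δ : A → Matrix ι ι ℂ} (h : ∀ a, (Δ a).PosSemidef)
    (a : A) : (restrict b Δ a).PosSemidef := by
  unfold restrict
  split_ifs
  · exact h a
  · exact Matrix.PosSemidef.zero

theorem mass_restrict_add (b : A → Prop) (Δ : A → Matrix ι ι ℂ) :
    mass (restrict b Δ) + mass (restrict (fun a => ¬ b a) Δ) = mass Δ := by
  simp only [mass]
  rw [← ENNReal.tsum_add]
  refine tsum_congr fun a => ?_
  by_cases h : b a <;> simp [restrict, h]

theorem isState_restrict (b : A → Prop) {Δ : A → Matrix ι ι ℂ} (h : IsState Δ) :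
    IsState (restrict b Δ) :=
  ⟨posSemidef_restrict b h.psd, (le_self_add.trans (mass_restrict_add b Δ).le).trans h.mass_le⟩

open Classical in
theorem expectation_restrict (b : A → Prop) {Δ : A → Matrix ι ι ℂ} (h : ∀ a, (Δ a).PosSemidef)
    (φ : A → InfPred ι) : expectation (restrict b Δ) φ
      = expectation Δ fun a => if b a then φ a else InfPred.scalar 0 := by
  refine tsum_congr fun a => ?_
  by_cases hb : b a <;> simp [restrict, hb, InfPred.expect_zero, InfPred.expect_scalar_zero (h a)]

theorem mass_add {Δ Δ' : A → Matrix ι ι ℂ} (h : ∀ a, (Δ a).PosSemidef)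
    (h' : ∀ a, (Δ' a).PosSemidef) : mass (Δ + Δ') = mass Δ + mass Δ' := by
  simp only [mass]
  rw [← ENNReal.tsum_add]
  refine tsum_congr fun a => ?_
  rw [Pi.add_apply, Matrix.trace_add, Complex.add_re,
    ENNReal.ofReal_add (trace_re_nonneg (h a)) (trace_re_nonneg (h' a))]

theorem InfPred.expect_add_matrix (φ : InfPred ι) {ρ ρ' : Matrix ι ι ℂ} (h : ρ.PosSemidef)
    (h' : ρ'.PosSemidef) : φ.expect (ρ + ρ') = φ.expect ρ + φ.expect ρ' := by
  simp only [InfPred.expect]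
  rw [← Finset.sum_add_distrib]
  refine Finset.sum_congr rfl fun i _ => ?_
  have h0 : ∀ {σ : Matrix ι ι ℂ}, σ.PosSemidef → 0 ≤ ((φ.basisᴴ * σ * φ.basis) i i).re :=
    fun hσ => (Complex.le_def.mp
      ((hσ.conjTranspose_mul_mul_same φ.basis).diag_nonneg (i := i))).1
  rw [Matrix.mul_add, Matrix.add_mul, Matrix.add_apply, Complex.add_re,
    ENNReal.ofReal_add (h0 h) (h0 h'), mul_add]

theorem expectation_add {Δ Δ' : A → Matrix ι ι ℂ} (h : ∀ a, (Δ a).PosSemidef)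
    (h' : ∀ a, (Δ' a).PosSemidef) (φ : A → InfPred ι) :
    expectation (Δ + Δ') φ = expectation Δ φ + expectation Δ' φ := by
  simp only [expectation]
  rw [← ENNReal.tsum_add]
  exact tsum_congr fun a => (φ a).expect_add_matrix (h a) (h' a)

/-! ### Marginals -/

theorem ptrace₂_mul_conjTranspose {K : Type*} [Fintype K] (B : Matrix (ι × κ) K ℂ) :
    ptrace₂ (B * Bᴴ) = (Matrix.of fun i (p : κ × K) => B (i, p.1) p.2)
      * (Matrix.of fun i (p : κ × K) => B (i, p.1) p.2)ᴴ := by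
  ext i i'
  simp [ptrace₂, Matrix.mul_apply, Fintype.sum_prod_type]

theorem ptrace₁_mul_conjTranspose {K : Type*} [Fintype K] (B : Matrix (ι × κ) K ℂ) :
    ptrace₁ (B * Bᴴ) = (Matrix.of fun j (p : ι × K) => B (p.1, j) p.2)
      * (Matrix.of fun j (p : ι × K) => B (p.1, j) p.2)ᴴ := by
  ext j j'
  simp [ptrace₁, Matrix.mul_apply, Fintype.sum_prod_type]

theorem posSemidef_ptrace₂ {ρ : Matrix (ι × κ) (ι × κ) ℂ} (h : ρ.PosSemidef) :
    (ptrace₂ ρ).PosSemidef := by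
  obtain ⟨B, rfl⟩ := exists_eq_mul_conjTranspose h
  rw [ptrace₂_mul_conjTranspose]
  exact Matrix.posSemidef_self_mul_conjTranspose _

theorem posSemidef_ptrace₁ {ρ : Matrix (ι × κ) (ι × κ) ℂ} (h : ρ.PosSemidef) :
    (ptrace₁ ρ).PosSemidef := by
  obtain ⟨B, rfl⟩ := exists_eq_mul_conjTranspose h
  rw [ptrace₁_mul_conjTranspose]
  exact Matrix.posSemidef_self_mul_conjTranspose _

theorem trace_ptrace₂ (ρ : Matrix (ι × κ) (ι × κ) ℂ) : (ptrace₂ ρ).trace = ρ.trace := by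
  simp [ptrace₂, Matrix.trace, Fintype.sum_prod_type]

theorem trace_ptrace₁ (ρ : Matrix (ι × κ) (ι × κ) ℂ) : (ptrace₁ ρ).trace = ρ.trace := by
  simp [ptrace₁, Matrix.trace, Fintype.sum_prod_type_right]

theorem mass_prod (Δ : A₁ × A₂ → Matrix ι ι ℂ) :
    mass Δ = ∑' a₁, ∑' a₂, ENNReal.ofReal (Δ (a₁, a₂)).trace.re :=
  ENNReal.tsum_prod'

theorem tsum_trace_left_ne_top {Δ : A₁ × A₂ → Matrix (ι × κ) (ι × κ) ℂ} (h : IsState Δ) :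
    ∑' a₂, mass (fun a₁ => ptrace₂ (Δ (a₁, a₂))) ≠ ∞ := by
  simp only [mass, trace_ptrace₂]
  rw [ENNReal.tsum_comm, ← mass_prod]
  exact ne_top_of_le_ne_top ENNReal.one_ne_top h.mass_le

theorem tsum_trace_right_ne_top {Δ : A₁ × A₂ → Matrix (ι × κ) (ι × κ) ℂ} (h : IsState Δ) :
    ∑' a₁, mass (fun a₂ => ptrace₁ (Δ (a₁, a₂))) ≠ ∞ := by
  simp only [mass, trace_ptrace₁]
  rw [← mass_prod]
  exact ne_top_of_le_ne_top ENNReal.one_ne_top h.mass_le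

theorem isState_tr₂ {Δ : A₁ × A₂ → Matrix (ι × κ) (ι × κ) ℂ} (h : IsState Δ) :
    IsState (tr₂ Δ) := by
  have hp : ∀ a₂ a₁, (ptrace₂ (Δ (a₁, a₂))).PosSemidef := fun _ _ => posSemidef_ptrace₂ (h.psd _)
  refine ⟨fun a => posSemidef_tsum fun a₂ => hp a₂ a, ?_⟩
  refine (mass_tsum hp (tsum_trace_left_ne_top h)).le.trans ?_
  simp only [mass, trace_ptrace₂]
  rw [ENNReal.tsum_comm, ← mass_prod]
  exact h.mass_le

theorem isState_tr₁ {Δ : A₁ × A₂ → Matrix (ι × κ) (ι × κ) ℂ} (h : IsState Δ) :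
    IsState (tr₁ Δ) := by
  have hp : ∀ a₁ a₂, (ptrace₁ (Δ (a₁, a₂))).PosSemidef := fun _ _ => posSemidef_ptrace₁ (h.psd _)
  refine ⟨fun a => posSemidef_tsum fun a₁ => hp a₁ a, ?_⟩
  refine (mass_tsum hp (tsum_trace_right_ne_top h)).le.trans ?_
  simp only [mass, trace_ptrace₁]
  rw [← mass_prod]
  exact h.mass_le

/-! ### Split assertions -/

theorem sum_enorm_sq_unitary {U : Matrix ι ι ℂ} (hU : U ∈ Matrix.unitaryGroup ι ℂ) (x : ι → ℂ) :
    ∑ i, ‖(Uᴴ *ᵥ x) i‖ₑ ^ 2 = ∑ i, ‖x i‖ₑ ^ 2 := by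
  have h := ofReal_trace_mul_conjTranspose (Uᴴ * Matrix.replicateCol Unit x)
  have h' := ofReal_trace_mul_conjTranspose (Matrix.replicateCol Unit x)
  have hU' : U * Uᴴ = 1 := Matrix.mem_unitaryGroup_iff.mp hU
  rw [Matrix.conjTranspose_mul, Matrix.conjTranspose_conjTranspose, Matrix.trace_mul_comm,
    Matrix.mul_assoc, ← Matrix.mul_assoc U, hU', Matrix.one_mul, Matrix.trace_mul_comm, h'] at h
  simpa [Matrix.mul_apply, Matrix.mulVec, dotProduct] using h.symm

/-- The eigenvalues of `r · I` in any spectral decomposition are `r`. -/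
theorem InfPred.eig_scalar (r : ℝ≥0∞) (i : ι) : (InfPred.scalar r : InfPred ι).eig i = r := by
  set S : InfPred ι := InfPred.scalar r
  have hU := S.isSpectral.1
  have hU' : S.basisᴴ * S.basis = 1 := Matrix.mem_unitaryGroup_iff'.mp hU
  have h1 := S.isSpectral.2 (S.basis *ᵥ Pi.single i 1)
  have h2 : S.form (S.basis *ᵥ Pi.single i 1)
      = r * ∑ j, ‖(S.basisᴴ *ᵥ (S.basis *ᵥ Pi.single i 1)) j‖ₑ ^ 2 := by
    rw [sum_enorm_sq_unitary hU, Finset.mul_sum]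
    rfl
  have h3 : ∀ j, ‖(Pi.single i (1 : ℂ) : ι → ℂ) j‖ₑ ^ 2 = if j = i then 1 else 0 := by
    intro j
    by_cases h : j = i
    · subst h; simp
    · simp [h]
  rw [h2] at h1
  simp only [Matrix.mulVec_mulVec, hU', Matrix.one_mulVec, h3] at h1
  simpa using h1.symm

theorem InfPred.tensor_one_form (A : InfPred ι) (x : ι × κ → ℂ) :
    (A.tensor (InfPred.scalar 1)).form x = ∑ j, A.form fun i => x (i, j) := by
  set S : InfPred κ := InfPred.scalar 1
  have hS1 : ∀ i, S.eig i = 1 := InfPred.eig_scalar 1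
  have h1 : ∀ p : ι × κ, ((Matrix.kronecker A.basis S.basis)ᴴ *ᵥ x) p
      = (S.basisᴴ *ᵥ fun j => (A.basisᴴ *ᵥ fun i => x (i, j)) p.1) p.2 := by
    intro p
    simp only [Matrix.mulVec, dotProduct, Matrix.conjTranspose_apply, Matrix.kronecker,
      Matrix.kroneckerMap_apply, Fintype.sum_prod_type, Finset.mul_sum, star_mul']
    rw [Finset.sum_comm]
    exact Finset.sum_congr rfl fun _ _ => Finset.sum_congr rfl fun _ _ => by ring
  simp only [InfPred.tensor, h1, Fintype.sum_prod_type, hS1, mul_one]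
  simp only [← Finset.mul_sum, sum_enorm_sq_unitary S.isSpectral.1, A.isSpectral.2]
  simp only [Finset.mul_sum]
  exact Finset.sum_comm

theorem InfPred.one_tensor_form (A : InfPred κ) (x : ι × κ → ℂ) :
    ((InfPred.scalar 1 : InfPred ι).tensor A).form x = ∑ i, A.form fun j => x (i, j) := by
  set S : InfPred ι := InfPred.scalar 1
  have hS1 : ∀ i, S.eig i = 1 := InfPred.eig_scalar 1
  have h1 : ∀ p : ι × κ, ((Matrix.kronecker S.basis A.basis)ᴴ *ᵥ x) p
      = (S.basisᴴ *ᵥ fun i => (A.basisᴴ *ᵥ fun j => x (i, j)) p.2) p.1 := by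
    intro p
    simp only [Matrix.mulVec, dotProduct, Matrix.conjTranspose_apply, Matrix.kronecker,
      Matrix.kroneckerMap_apply, Fintype.sum_prod_type, Finset.mul_sum, star_mul']
    exact Finset.sum_congr rfl fun _ _ => Finset.sum_congr rfl fun _ _ => by ring
  simp only [InfPred.tensor, h1, Fintype.sum_prod_type_right, hS1, one_mul]
  simp only [← Finset.mul_sum, sum_enorm_sq_unitary S.isSpectral.1, A.isSpectral.2]
  simp only [Finset.mul_sum]
  exact Finset.sum_comm

theorem split_form (φ₁ : A₁ → InfPred ι) (φ₂ : A₂ → InfPred κ) (a : A₁ × A₂) (x : ι × κ → ℂ) :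
    (split φ₁ φ₂ a).form x
      = (∑ j, (φ₁ a.1).form fun i => x (i, j)) + ∑ i, (φ₂ a.2).form fun j => x (i, j) := by
  rw [← InfPred.tensor_one_form, ← InfPred.one_tensor_form]
  rfl

theorem split_expect (φ₁ : A₁ → InfPred ι) (φ₂ : A₂ → InfPred κ) (a : A₁ × A₂)
    {ρ : Matrix (ι × κ) (ι × κ) ℂ} (h : ρ.PosSemidef) :
    (split φ₁ φ₂ a).expect ρ = (φ₁ a.1).expect (ptrace₂ ρ) + (φ₂ a.2).expect (ptrace₁ ρ) := by
  obtain ⟨B, rfl⟩ := exists_eq_mul_conjTranspose h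
  rw [ptrace₂_mul_conjTranspose, ptrace₁_mul_conjTranspose]
  simp only [InfPred.expect_mul_conjTranspose, split_form, Finset.sum_add_distrib,
    Fintype.sum_prod_type_right]
  rfl

/-- The expected value of a split assertion depends only on the two marginals, so
all couplings of two given states agree on it. -/
theorem expectation_split {Δ : A₁ × A₂ → Matrix (ι × κ) (ι × κ) ℂ} (h : IsState Δ)
    (φ₁ : A₁ → InfPred ι) (φ₂ : A₂ → InfPred κ) :
    expectation Δ (split φ₁ φ₂) = expectation (tr₂ Δ) φ₁ + expectation (tr₁ Δ) φ₂ := by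
  have e1 := expectation_tsum (ρ := fun a₂ a₁ => ptrace₂ (Δ (a₁, a₂)))
    (fun _ _ => posSemidef_ptrace₂ (h.psd _)) (tsum_trace_left_ne_top h) φ₁
  have e2 := expectation_tsum (ρ := fun a₁ a₂ => ptrace₁ (Δ (a₁, a₂)))
    (fun _ _ => posSemidef_ptrace₁ (h.psd _)) (tsum_trace_right_ne_top h) φ₂
  refine Eq.trans ?_ (congrArg₂ (· + ·) e1 e2).symm
  simp only [expectation, split_expect _ _ _ (h.psd _)]
  rw [ENNReal.tsum_add, ENNReal.tsum_prod', ENNReal.tsum_prod', ENNReal.tsum_comm]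

end Families

/-! ### Kraus families -/

section Kraus

variable {V ι κ : Type*} [Fintype ι] [DecidableEq ι] [Fintype κ] [DecidableEq κ]

theorem tsum_trace_kraus {K : V → Matrix ι ι ℂ} (hK : HasSum (fun v => (K v)ᴴ * K v) 1)
    {ρ : Matrix ι ι ℂ} (hρ : ρ.PosSemidef) :
    ∑' v, ENNReal.ofReal (K v * ρ * (K v)ᴴ).trace.re = ENNReal.ofReal ρ.trace.re := by
  have h1 := Complex.hasSum_re ((hK.mul_right ρ).map (Matrix.traceAddMonoidHom ι ℂ)
    continuous_id.matrix_trace)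
  have h2 : ∀ v, ((K v)ᴴ * K v * ρ).trace = (K v * ρ * (K v)ᴴ).trace := fun v => by
    rw [Matrix.mul_assoc, Matrix.trace_mul_comm]
  simp only [Function.comp_def, Matrix.traceAddMonoidHom_apply, h2, Matrix.one_mul] at h1
  rw [← h1.tsum_eq]
  exact (ENNReal.ofReal_tsum_of_nonneg
    (fun v => trace_re_nonneg (hρ.mul_mul_conjTranspose_same (K v))) h1.summable).symm

theorem tsum_enorm_sq_kraus {K : V → Matrix ι ι ℂ} (hK : HasSum (fun v => (K v)ᴴ * K v) 1)
    (z : ι → ℂ) : ∑' v, ∑ i, ‖(K v *ᵥ z) i‖ₑ ^ 2 = ∑ i, ‖z i‖ₑ ^ 2 := by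
  have h0 := ofReal_trace_mul_conjTranspose (Matrix.replicateCol Unit z)
  have h1 := tsum_trace_kraus hK
    (Matrix.posSemidef_self_mul_conjTranspose (Matrix.replicateCol Unit z))
  have h2 : ∀ v, K v * (Matrix.replicateCol Unit z * (Matrix.replicateCol Unit z)ᴴ) * (K v)ᴴ
      = (K v * Matrix.replicateCol Unit z) * (K v * Matrix.replicateCol Unit z)ᴴ := fun v => by
    simp only [Matrix.conjTranspose_mul, Matrix.mul_assoc]
  simp only [h2, ofReal_trace_mul_conjTranspose] at h1
  simpa [Matrix.mul_apply, Matrix.mulVec, dotProduct] using h1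

/-- A Kraus family on the first factor does not affect a form on the second factor. -/
theorem tsum_form_kraus_left {K : V → Matrix ι ι ℂ} (hK : HasSum (fun v => (K v)ᴴ * K v) 1)
    (A : InfPred κ) (x : ι × κ → ℂ) :
    ∑' v, ∑ i, A.form (fun j => (K v *ᵥ fun i' => x (i', j)) i)
      = ∑ i, A.form fun j => x (i, j) := by
  have h1 : ∀ v i l, (A.basisᴴ *ᵥ fun j => (K v *ᵥ fun i' => x (i', j)) i) l
      = (K v *ᵥ fun i' => (A.basisᴴ *ᵥ fun j => x (i', j)) l) i := by
    intro v i l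
    simp only [Matrix.mulVec, dotProduct, Finset.mul_sum]
    rw [Finset.sum_comm]
    exact Finset.sum_congr rfl fun _ _ => Finset.sum_congr rfl fun _ _ => by ring
  simp only [A.isSpectral.2, h1]
  have h2 : ∀ y : ι → κ → ℝ≥0∞, ∑ i, ∑ l, A.eig l * y i l = ∑ l, A.eig l * ∑ i, y i l := by
    intro y
    rw [Finset.sum_comm]
    simp only [Finset.mul_sum]
  simp only [h2]
  rw [Summable.tsum_finsetSum fun _ _ => ENNReal.summable]
  simp only [ENNReal.tsum_mul_left, tsum_enorm_sq_kraus hK]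

/-- A Kraus family on the second factor does not affect a form on the first factor. -/
theorem tsum_form_kraus_right {K : V → Matrix κ κ ℂ} (hK : HasSum (fun v => (K v)ᴴ * K v) 1)
    (A : InfPred ι) (x : ι × κ → ℂ) :
    ∑' v, ∑ j, A.form (fun i => (K v *ᵥ fun j' => x (i, j')) j)
      = ∑ j, A.form fun i => x (i, j) :=
  tsum_form_kraus_left hK A fun p : κ × ι => x p.swap

end Kraus

/-! ### Operators on registers -/

section Registers

variable {C Val Q : Type*} [Fintype Q] [DecidableEq Q] {d : Q → ℕ}

/-- The operator `K_S` is `K ⊗ 1` for the decomposition of the whole space into the register `S`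
and the other quantum variables. -/
theorem extend_eq_submatrix (S : Finset Q) (K : Matrix (RIdx d S) (RIdx d S) ℂ) :
    extend S K = (Matrix.kronecker K (1 : Matrix (∀ q : {q // q ∉ S}, Fin (d q)) _ ℂ)).submatrix
      (Equiv.piEquivPiSubtypeProd (· ∈ S) fun q => Fin (d q))
      (Equiv.piEquivPiSubtypeProd (· ∈ S) fun q => Fin (d q)) := by
  ext s t
  have h : (∀ q, q ∉ S → s q = t q) ↔
      (fun q : {q // q ∉ S} => s q) = fun q : {q // q ∉ S} => t q := by
    simp [funext_iff]
  simp only [extend, h, Matrix.submatrix_apply, Matrix.kronecker, Matrix.kroneckerMap_apply,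
    Matrix.one_apply, Equiv.piEquivPiSubtypeProd_apply, mul_ite, mul_one, mul_zero]

theorem extend_mul (S : Finset Q) (K L : Matrix (RIdx d S) (RIdx d S) ℂ) :
    extend S (K * L) = extend S K * extend S L := by
  simp only [extend_eq_submatrix]
  rw [Matrix.submatrix_mul_equiv]
  simp [Matrix.kronecker, ← Matrix.mul_kronecker_mul]

theorem extend_conjTranspose (S : Finset Q) (K : Matrix (RIdx d S) (RIdx d S) ℂ) :
    extend S Kᴴ = (extend S K)ᴴ := by
  ext s t
  simp only [extend, Matrix.conjTranspose_apply, @eq_comm _ (s _)]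
  split_ifs <;> simp

theorem extend_one (S : Finset Q) : extend S (1 : Matrix (RIdx d S) (RIdx d S) ℂ) = 1 := by
  rw [extend_eq_submatrix]
  simp [Matrix.kronecker]

theorem hasSum_extend {V : Type*} (S : Finset Q) {K : V → Matrix (RIdx d S) (RIdx d S) ℂ}
    (hK : HasSum (fun v => (K v)ᴴ * K v) 1) :
    HasSum (fun v => (extend S (K v))ᴴ * extend S (K v)) 1 := by
  simp only [← extend_conjTranspose, ← extend_mul, ← extend_one S]
  refine Pi.hasSum.mpr fun s => Pi.hasSum.mpr fun t => ?_
  simp only [extend]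
  split_ifs
  · exact Pi.hasSum.mp (Pi.hasSum.mp hK _) _
  · exact hasSum_zero

theorem hasSum_unitary (S : Finset Q) (U : Matrix.unitaryGroup (RIdx d S) ℂ) :
    HasSum (fun _ : Unit => (extend S U.1)ᴴ * extend S U.1) 1 := by
  refine hasSum_extend S (K := fun _ : Unit => U.1) ?_
  have : U.1ᴴ * U.1 = 1 := Matrix.mem_unitaryGroup_iff'.mp U.2
  rw [this]
  exact hasSum_unique (f := fun _ : Unit => (1 : Matrix (RIdx d S) (RIdx d S) ℂ))

theorem hasSum_initOp (S : Finset Q) (v : {v : RIdx d S → ℂ // star v ⬝ᵥ v = 1}) :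
    HasSum (fun i => (initOp S v.1 i)ᴴ * initOp S v.1 i) 1 := by
  refine hasSum_extend S ?_
  convert hasSum_fintype (fun i : RIdx d S =>
    (Matrix.vecMulVec v.1 (Pi.single i 1))ᴴ * Matrix.vecMulVec v.1 (Pi.single i 1))
  ext s t
  simp only [Matrix.conjTranspose_vecMulVec, Matrix.vecMulVec_mul_vecMulVec, v.2]
  simp [Matrix.sum_apply, Matrix.vecMulVec_apply, Pi.single_apply, Matrix.one_apply]

end Registers

/-! ### Weakest preconditions of a single program -/

section WP

variable {C Val Q : Type*} [Fintype Q] [DecidableEq Q] {d : Q → ℕ}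

open Classical in
/-- The contribution to the weakest precondition of a loop of the runs with exactly `n` iterations,
where `w` is the weakest precondition of the body. -/
noncomputable def loopRuns (b : Mem C Val → Prop)
    (w : (Mem C Val → InfPred (QIdx d)) → Mem C Val → InfPred (QIdx d))
    (φ : Mem C Val → InfPred (QIdx d)) : ℕ → Mem C Val → InfPred (QIdx d)
  | 0 => fun σ => if b σ then .scalar 0 else φ σ
  | n + 1 => fun σ => if b σ then w (loopRuns b w φ n) σ else .scalar 0

open Classical in
/-- The weakest precondition of an assertion with respect to a program. A nonterminating run
contributes `0`. For a loop it is a sum over the number of iterations, so that no suprema of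
increasing sequences are needed. -/
noncomputable def Cmd.wp : Cmd C Val d → (Mem C Val → InfPred (QIdx d)) →
    Mem C Val → InfPred (QIdx d)
  | .skip => fun φ => φ
  | .abort => fun _ _ => .scalar 0
  | .assign x e => fun φ σ => φ (upd σ x (e σ))
  | .sample x μ => fun φ σ => .sum fun v => .smul (μ v) (φ (upd σ x v))
  | .init S v => fun φ σ => .sum fun i => .conj (initOp S (v σ) i) (φ σ)
  | .apply S U => fun φ σ => .conj (extend S U) (φ σ)
  | .measure x S M => fun φ σ => .sum fun v => .conj (extend S (M.op v)) (φ (upd σ x v))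
  | .seq c c' => fun φ => c.wp (c'.wp φ)
  | .ite b c c' => fun φ σ => if b σ then c.wp φ σ else c'.wp φ σ
  | .loop b c => fun φ σ => .sum fun n : ℕ => loopRuns b c.wp φ n σ

theorem InfPred.sum_comm {ι V W : Type*} [Fintype ι] [DecidableEq ι] (A : V → W → InfPred ι) :
    (InfPred.sum fun v => InfPred.sum fun w => A v w)
      = InfPred.sum fun w => InfPred.sum fun v => A v w :=
  InfPred.ext (funext fun _ => ENNReal.tsum_comm)

theorem InfPred.sum_zero {ι V : Type*} [Fintype ι] [DecidableEq ι] :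
    (InfPred.sum fun _ : V => InfPred.scalar 0) = (InfPred.scalar 0 : InfPred ι) := by
  ext x
  simp [InfPred.sum, InfPred.scalar]

theorem InfPred.smul_sum {ι V : Type*} [Fintype ι] [DecidableEq ι] (r : ℝ≥0∞)
    (A : V → InfPred ι) :
    InfPred.smul r (InfPred.sum A) = InfPred.sum fun v => InfPred.smul r (A v) :=
  InfPred.ext (funext fun _ => ENNReal.tsum_mul_left.symm)

theorem InfPred.conj_sum {ι V : Type*} [Fintype ι] [DecidableEq ι] (K : Matrix ι ι ℂ)
    (A : V → InfPred ι) :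
    InfPred.conj K (InfPred.sum A) = InfPred.sum fun v => InfPred.conj K (A v) :=
  rfl

theorem loopRuns_sum {W : Type*} (b : Mem C Val → Prop)
    {w : (Mem C Val → InfPred (QIdx d)) → Mem C Val → InfPred (QIdx d)}
    (hw : ∀ φ : W → Mem C Val → InfPred (QIdx d),
      w (fun σ => .sum fun k => φ k σ) = fun σ => .sum fun k => w (φ k) σ)
    (φ : W → Mem C Val → InfPred (QIdx d)) (n : ℕ) :
    loopRuns b w (fun σ => .sum fun k => φ k σ) n
      = fun σ => .sum fun k => loopRuns b w (φ k) n σ := by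
  induction n with
  | zero =>
    funext σ
    by_cases h : b σ <;> simp [loopRuns, h, InfPred.sum_zero]
  | succ n ih =>
    funext σ
    by_cases h : b σ <;> simp [loopRuns, h, InfPred.sum_zero, ih, hw]

/-- Weakest preconditions are countably additive. -/
theorem Cmd.wp_sum {W : Type*} (c : Cmd C Val d) (φ : W → Mem C Val → InfPred (QIdx d)) :
    c.wp (fun σ => .sum fun w => φ w σ) = fun σ => .sum fun w => c.wp (φ w) σ := by
  induction c generalizing φ with
  | skip => rfl
  | abort => exact funext fun σ => InfPred.sum_zero.symm
  | assign x e => rfl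
  | sample x μ =>
    funext σ
    simp only [Cmd.wp, InfPred.smul_sum]
    exact InfPred.sum_comm _
  | init S v =>
    funext σ
    simp only [Cmd.wp, InfPred.conj_sum]
    exact InfPred.sum_comm _
  | apply S U => rfl
  | measure x S M =>
    funext σ
    simp only [Cmd.wp, InfPred.conj_sum]
    exact InfPred.sum_comm _
  | seq c c' ih ih' => simp only [Cmd.wp, ih', ih]
  | ite b c c' ih ih' =>
    funext σ
    by_cases h : b σ <;> simp only [Cmd.wp, ih, ih', h, if_true, if_false]
  | loop b c ih =>
    funext σ
    simp only [Cmd.wp, loopRuns_sum b ih]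
    exact InfPred.sum_comm _

open Classical in
/-- The weakest precondition of a loop is a fixed point of its unrolling. -/
theorem Cmd.wp_loop (b : Mem C Val → Prop) (c : Cmd C Val d) (φ : Mem C Val → InfPred (QIdx d))
    (σ : Mem C Val) :
    (Cmd.loop b c).wp φ σ = if b σ then c.wp ((Cmd.loop b c).wp φ) σ else φ σ := by
  have h1 : (Cmd.loop b c).wp φ = fun σ => .sum fun n : ℕ => loopRuns b c.wp φ n σ := by
    simp only [Cmd.wp]
  rw [h1, Cmd.wp_sum]
  ext x
  simp only [InfPred.sum]
  rw [tsum_eq_zero_add' ENNReal.summable]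
  by_cases h : b σ <;> simp [loopRuns, h, InfPred.scalar]

/-! ### Duality of the semantics and weakest preconditions -/

/-- The state transformer `D` maps states to states and is dual to the assertion transformer `w`. -/
structure IsDual (D : (Mem C Val → Matrix (QIdx d) (QIdx d) ℂ) →
      Mem C Val → Matrix (QIdx d) (QIdx d) ℂ)
    (w : (Mem C Val → InfPred (QIdx d)) → Mem C Val → InfPred (QIdx d)) : Prop where
  psd : ∀ Δ, IsState Δ → ∀ σ, (D Δ σ).PosSemidef
  mass_le : ∀ Δ, IsState Δ → mass (D Δ) ≤ mass Δ
  expectation_eq : ∀ Δ, IsState Δ → ∀ φ, expectation (D Δ) φ = expectation Δ (w φ)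

theorem IsDual.isState {D w} (h : IsDual (C := C) (Val := Val) (d := d) D w)
    {Δ : Mem C Val → Matrix (QIdx d) (QIdx d) ℂ} (hΔ : IsState Δ) : IsState (D Δ) :=
  ⟨h.psd Δ hΔ, (h.mass_le Δ hΔ).trans hΔ.mass_le⟩

/-- Duality for the linear extension of a map that sends a simple state at `σ` to the sum of the
simple states at `g σ v` obtained by applying `T σ v`. -/
theorem isDual_lift {V : Type*} (g : Mem C Val → V → Mem C Val)
    (T : Mem C Val → V → Matrix (QIdx d) (QIdx d) ℂ → Matrix (QIdx d) (QIdx d) ℂ)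
    {f : Mem C Val → Matrix (QIdx d) (QIdx d) ℂ → Mem C Val → Matrix (QIdx d) (QIdx d) ℂ}
    (hf : ∀ σ ρ τ, f σ ρ τ = ∑' v, simple (g σ v) (T σ v ρ) τ)
    (hT : ∀ σ v ρ, ρ.PosSemidef → (T σ v ρ).PosSemidef)
    (hm : ∀ σ ρ, ρ.PosSemidef →
      ∑' v, ENNReal.ofReal (T σ v ρ).trace.re = ENNReal.ofReal ρ.trace.re)
    {w : (Mem C Val → InfPred (QIdx d)) → Mem C Val → InfPred (QIdx d)}
    (hw : ∀ φ σ ρ, ρ.PosSemidef →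
      (w φ σ).expect ρ = ∑' v, (φ (g σ v)).expect (T σ v ρ)) :
    IsDual (lift f) w := by
  have hf' : ∀ σ ρ, f σ ρ = fun τ => ∑' v, simple (g σ v) (T σ v ρ) τ :=
    fun σ ρ => funext (hf σ ρ)
  have hs : ∀ σ ρ, ρ.PosSemidef → ∀ v τ, (simple (g σ v) (T σ v ρ) τ).PosSemidef :=
    fun σ ρ hρ v τ => posSemidef_simple _ (hT σ v ρ hρ) τ
  have hfin : ∀ σ ρ, ρ.PosSemidef → ∑' v, mass (simple (g σ v) (T σ v ρ)) ≠ ∞ := by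
    intro σ ρ hρ
    simp only [mass_simple, hm σ ρ hρ]
    exact ENNReal.ofReal_ne_top
  have hfp : ∀ σ ρ, ρ.PosSemidef → ∀ τ, (f σ ρ τ).PosSemidef := by
    intro σ ρ hρ τ
    rw [hf]
    exact posSemidef_tsum fun v => hs σ ρ hρ v τ
  have hfm : ∀ σ ρ, ρ.PosSemidef → mass (f σ ρ) = ENNReal.ofReal ρ.trace.re := by
    intro σ ρ hρ
    rw [hf', mass_tsum (hs σ ρ hρ) (hfin σ ρ hρ)]
    simp only [mass_simple, hm σ ρ hρ]
  have hΔm : ∀ Δ, IsState Δ → ∑' σ, mass (f σ (Δ σ)) = mass Δ :=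
    fun Δ hΔ => tsum_congr fun σ => hfm σ _ (hΔ.psd σ)
  have hΔfin : ∀ Δ, IsState Δ → ∑' σ, mass (f σ (Δ σ)) ≠ ∞ := fun Δ hΔ => by
    rw [hΔm Δ hΔ]
    exact ne_top_of_le_ne_top ENNReal.one_ne_top hΔ.mass_le
  refine ⟨fun Δ hΔ τ => posSemidef_tsum fun σ => hfp σ _ (hΔ.psd σ) τ, fun Δ hΔ => ?_,
    fun Δ hΔ φ => ?_⟩
  · exact ((mass_tsum (fun σ => hfp σ _ (hΔ.psd σ)) (hΔfin Δ hΔ)).trans (hΔm Δ hΔ)).le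
  · refine (expectation_tsum (fun σ => hfp σ _ (hΔ.psd σ)) (hΔfin Δ hΔ) φ).trans ?_
    refine tsum_congr fun σ => ?_
    rw [hw φ σ _ (hΔ.psd σ), hf', expectation_tsum (hs σ _ (hΔ.psd σ)) (hfin σ _ (hΔ.psd σ))]
    simp only [expectation_simple]

open Classical in
theorem isDual_ite (b : Mem C Val → Prop) {c c' : Cmd C Val d} (h : IsDual c.den c.wp)
    (h' : IsDual c'.den c'.wp) : IsDual (Cmd.ite b c c').den (Cmd.ite b c c').wp := by
  have hr := fun Δ (hΔ : IsState Δ) => h.isState (isState_restrict b hΔ)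
  have hr' := fun Δ (hΔ : IsState Δ) => h'.isState (isState_restrict (fun σ => ¬ b σ) hΔ)
  refine ⟨fun Δ hΔ σ => ((hr Δ hΔ).psd σ).add ((hr' Δ hΔ).psd σ), fun Δ hΔ => ?_,
    fun Δ hΔ φ => ?_⟩
  · simp only [Cmd.den]
    rw [mass_add (hr Δ hΔ).psd (hr' Δ hΔ).psd, ← mass_restrict_add b Δ]
    exact add_le_add (h.mass_le _ (isState_restrict _ hΔ)) (h'.mass_le _ (isState_restrict _ hΔ))
  · simp only [Cmd.den]
    rw [expectation_add (hr Δ hΔ).psd (hr' Δ hΔ).psd, h.expectation_eq _ (isState_restrict _ hΔ),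
      h'.expectation_eq _ (isState_restrict _ hΔ), expectation_restrict _ hΔ.psd,
      expectation_restrict _ hΔ.psd]
    simp only [expectation]
    rw [← ENNReal.tsum_add]
    refine tsum_congr fun σ => ?_
    by_cases hb : b σ <;> simp [Cmd.wp, hb, InfPred.expect_scalar_zero (hΔ.psd σ)]

open Classical in
theorem isDual_loop (b : Mem C Val → Prop) {c : Cmd C Val d} (h : IsDual c.den c.wp) :
    IsDual (Cmd.loop b c).den (Cmd.loop b c).wp := by
  set D : (Mem C Val → Matrix (QIdx d) (QIdx d) ℂ) → Mem C Val → Matrix (QIdx d) (QIdx d) ℂ :=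
    fun Δ => c.den (restrict b Δ) with hD
  have hstep : ∀ Δ, IsState Δ → IsState (D Δ) := fun Δ hΔ => h.isState (isState_restrict b hΔ)
  have hit : ∀ n Δ, IsState Δ → IsState (D^[n] Δ) := by
    intro n
    induction n with
    | zero => exact fun Δ hΔ => hΔ
    | succ n ih => exact fun Δ hΔ => ih _ (hstep Δ hΔ)
  have hex : ∀ n Δ, IsState Δ → IsState (restrict (fun σ => ¬ b σ) (D^[n] Δ)) :=
    fun n Δ hΔ => isState_restrict _ (hit n Δ hΔ)
  -- The mass that has left the loop and the mass still inside it never exceed the initial mass.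
  have hpart : ∀ Δ, IsState Δ → ∀ N, (∑ n ∈ Finset.range N,
      mass (restrict (fun σ => ¬ b σ) (D^[n] Δ))) + mass (D^[N] Δ) ≤ mass Δ := by
    intro Δ hΔ N
    induction N with
    | zero => simp
    | succ N ih =>
      refine le_trans ?_ ih
      rw [Finset.sum_range_succ, add_assoc, ← mass_restrict_add b (D^[N] Δ),
        add_comm (mass (restrict b (D^[N] Δ))), Function.iterate_succ_apply']
      gcongr
      exact h.mass_le _ (isState_restrict b (hit N Δ hΔ))
  have hsum : ∀ Δ, IsState Δ →
      ∑' n, mass (restrict (fun σ => ¬ b σ) (D^[n] Δ)) ≤ mass Δ := by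
    intro Δ hΔ
    rw [ENNReal.tsum_eq_iSup_nat]
    exact iSup_le fun N => le_self_add.trans (hpart Δ hΔ N)
  have hfin : ∀ Δ, IsState Δ → ∑' n, mass (restrict (fun σ => ¬ b σ) (D^[n] Δ)) ≠ ∞ :=
    fun Δ hΔ => ne_top_of_le_ne_top ENNReal.one_ne_top ((hsum Δ hΔ).trans hΔ.mass_le)
  refine ⟨fun Δ hΔ σ => posSemidef_tsum fun n => (hex n Δ hΔ).psd σ, fun Δ hΔ => ?_,
    fun Δ hΔ φ => ?_⟩
  · exact (mass_tsum (fun n => (hex n Δ hΔ).psd) (hfin Δ hΔ)).le.trans (hsum Δ hΔ)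
  · have key : ∀ n Δ, IsState Δ → expectation (restrict (fun σ => ¬ b σ) (D^[n] Δ)) φ
        = expectation Δ (loopRuns b c.wp φ n) := by
      intro n
      induction n with
      | zero =>
        intro Δ hΔ
        rw [Function.iterate_zero_apply, expectation_restrict _ hΔ.psd]
        refine congrArg (expectation Δ) (funext fun σ => ?_)
        by_cases hb : b σ <;> simp [loopRuns, hb]
      | succ n ih =>
        intro Δ hΔ
        rw [Function.iterate_succ_apply, ih _ (hstep Δ hΔ),
          h.expectation_eq _ (isState_restrict b hΔ), expectation_restrict _ hΔ.psd]
        rfl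
    refine (expectation_tsum (fun n => (hex n Δ hΔ).psd) (hfin Δ hΔ) φ).trans ?_
    rw [tsum_congr fun n => key n Δ hΔ]
    simp only [expectation]
    rw [ENNReal.tsum_comm]
    refine tsum_congr fun σ => ?_
    rw [Cmd.wp, InfPred.expect_sum _ (hΔ.psd σ)]

theorem isDual_assign (x : C) (e : Mem C Val → Val) :
    IsDual (Cmd.assign (d := d) x e).den (Cmd.assign x e).wp := by
  rw [Cmd.den]
  exact isDual_lift (V := Unit) (fun σ _ => upd σ x (e σ)) (fun _ _ ρ => ρ) (by simp)
    (fun _ _ _ h => h) (by simp) (by simp [Cmd.wp])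

theorem isDual_sample (x : C) (μ : PMF Val) :
    IsDual (Cmd.sample (d := d) x μ).den (Cmd.sample x μ).wp := by
  have hμ : ∀ v, ENNReal.ofReal (μ v).toReal = μ v :=
    fun v => ENNReal.ofReal_toReal (μ.apply_ne_top v)
  rw [Cmd.den]
  refine isDual_lift (fun σ v => upd σ x v) (fun _ v ρ => evalDist μ ρ v) (fun _ _ _ => rfl)
    (fun _ v ρ h => h.smul (by simp)) (fun _ ρ h => ?_) (fun φ σ ρ h => ?_)
  · simp only [evalDist, Matrix.trace_smul, smul_eq_mul, Complex.re_ofReal_mul]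
    simp only [ENNReal.ofReal_mul ENNReal.toReal_nonneg, hμ, ENNReal.tsum_mul_right, μ.tsum_coe,
      one_mul]
  · simp only [Cmd.wp, InfPred.expect_sum _ h, InfPred.expect_smul _ _ h, evalDist,
      InfPred.expect_smul_matrix _ ENNReal.toReal_nonneg, hμ]

theorem isDual_init (S : Finset Q) (v : Mem C Val → {v : RIdx d S → ℂ // star v ⬝ᵥ v = 1}) :
    IsDual (Cmd.init S v).den (Cmd.init S v).wp := by
  rw [Cmd.den]
  refine isDual_lift (fun σ _ => σ)
    (fun σ i ρ => initOp S (v σ) i * ρ * (initOp S (v σ) i)ᴴ) (fun σ ρ τ => ?_)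
    (fun σ i ρ h => ?_) (fun σ ρ h => ?_) (fun φ σ ρ h => ?_)
  · rw [tsum_fintype]
    unfold simple
    split_ifs <;> simp
  · exact (h.mul_mul_conjTranspose_same (initOp S (v σ) i) :)
  · exact tsum_trace_kraus (hasSum_initOp S (v σ)) h
  · simp only [Cmd.wp, InfPred.expect_sum _ h, InfPred.expect_conj _ _ h]

theorem isDual_apply (S : Finset Q) (U : Matrix.unitaryGroup (RIdx d S) ℂ) :
    IsDual (Cmd.apply (C := C) (Val := Val) S U).den (Cmd.apply S U).wp := by
  rw [Cmd.den]
  refine isDual_lift (V := Unit) (fun σ _ => σ)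
    (fun _ _ ρ => extend S U * ρ * (extend S U)ᴴ) (by simp)
    (fun σ i ρ h => ?_) (fun σ ρ h => ?_) (fun φ σ ρ h => ?_)
  · exact (h.mul_mul_conjTranspose_same (extend S U.1) :)
  · exact tsum_trace_kraus (hasSum_unitary S U) h
  · simp [Cmd.wp, InfPred.expect_conj _ _ h]

theorem isDual_measure (x : C) (S : Finset Q) (M : Measurement Val (RIdx d S)) :
    IsDual (Cmd.measure x S M).den (Cmd.measure x S M).wp := by
  rw [Cmd.den]
  refine isDual_lift (fun σ v => upd σ x v)
    (fun _ v ρ => evalMeas (fun v => extend S (M.op v)) ρ v) (fun _ _ _ => rfl)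
    (fun σ i _ h => h.mul_mul_conjTranspose_same _)
    (fun σ ρ h => tsum_trace_kraus (hasSum_extend S M.complete) h) (fun φ σ ρ h => ?_)
  simp only [Cmd.wp, InfPred.expect_sum _ h, InfPred.expect_conj _ _ h, evalMeas]

/-- The denotational semantics is dual to the weakest precondition. -/
theorem Cmd.isDual (c : Cmd C Val d) : IsDual c.den c.wp := by
  induction c with
  | skip => exact ⟨fun Δ hΔ => hΔ.psd, fun _ _ => le_rfl, fun _ _ _ => rfl⟩
  | abort =>
    refine ⟨fun _ _ _ => Matrix.PosSemidef.zero, fun _ _ => by simp [Cmd.den, mass],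
      fun Δ hΔ φ => ?_⟩
    simp [Cmd.den, Cmd.wp, expectation, InfPred.expect_zero,
      InfPred.expect_scalar_zero (hΔ.psd _)]
  | assign x e => exact isDual_assign x e
  | sample x μ => exact isDual_sample x μ
  | init S v => exact isDual_init S v
  | apply S U => exact isDual_apply S U
  | measure x S M => exact isDual_measure x S M
  | seq c c' h h' =>
    exact ⟨fun Δ hΔ => h'.psd _ (h.isState hΔ),
      fun Δ hΔ => (h'.mass_le _ (h.isState hΔ)).trans (h.mass_le _ hΔ),
      fun Δ hΔ φ => (h'.expectation_eq _ (h.isState hΔ) φ).trans (h.expectation_eq _ hΔ _)⟩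
  | ite b c c' h h' => exact isDual_ite b h h'
  | loop b c h => exact isDual_loop b h

end WP

/-! ### Derivations in the one-sided fragment -/

section Derivations

variable {C₁ C₂ Val Q₁ Q₂ : Type*} [Fintype Q₁] [DecidableEq Q₁] [Fintype Q₂] [DecidableEq Q₂]
  {d₁ : Q₁ → ℕ} {d₂ : Q₂ → ℕ} {s : System}

theorem Derivable.mono {ψ' φ' ψ φ : RAssn C₁ C₂ Val d₁ d₂} {c₁ : Cmd C₁ Val d₁}
    {c₂ : Cmd C₂ Val d₂} (h : Derivable s ψ' c₁ c₂ φ')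
    (hψ : ∀ Δ, IsState Δ → expectation Δ ψ' ≤ expectation Δ ψ) (hφ : ∀ σ, φ σ ≤ φ' σ) :
    Derivable s ψ c₁ c₂ φ :=
  h.conseq fun Δ _ _ hΔ _ _ hinf => (iInf₂_mono fun _ hΔ' =>
    expectation_mono hφ (IsCoupling.isState hΔ').psd).trans (hinf.trans (hψ Δ hΔ))

theorem Derivable.strengthen {ψ' ψ φ : RAssn C₁ C₂ Val d₁ d₂} {c₁ : Cmd C₁ Val d₁}
    {c₂ : Cmd C₂ Val d₂} (h : Derivable s ψ' c₁ c₂ φ) (hψ : ∀ σ, ψ' σ ≤ ψ σ) :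
    Derivable s ψ c₁ c₂ φ :=
  h.mono (fun _ hΔ => expectation_mono hψ hΔ.psd) fun _ _ => le_rfl

/-- A guarded assertion only has to be bounded from below where the guard holds. -/
theorem le_guard {A ι : Type*} [Fintype ι] [DecidableEq ι] {b : A → Prop} {φ ψ : A → InfPred ι}
    (h : ∀ a, b a → φ a = ψ a) (a : A) : φ a ≤ guard b ψ a := by
  unfold guard
  split_ifs with hb
  · rw [h a hb]
    exact fun _ => le_rfl
  · exact InfPred.le_scalar_top _

theorem split_congr {A₁ A₂ ι κ : Type*} [Fintype ι] [DecidableEq ι] [Fintype κ] [DecidableEq κ]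
    {φ₁ ψ₁ : A₁ → InfPred ι} {φ₂ ψ₂ : A₂ → InfPred κ} {a : A₁ × A₂} (h₁ : φ₁ a.1 = ψ₁ a.1)
    (h₂ : φ₂ a.2 = ψ₂ a.2) : split φ₁ φ₂ a = split ψ₁ ψ₂ a := by
  simp only [split, h₁, h₂]

theorem onLeft_mulVec (K : Matrix (QIdx d₁) (QIdx d₁) ℂ) (x : QIdx d₁ × QIdx d₂ → ℂ)
    (i : QIdx d₁) (j : QIdx d₂) :
    (onLeft K *ᵥ x) (i, j) = (K *ᵥ fun i' => x (i', j)) i := by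
  simp [onLeft, Matrix.mulVec, dotProduct, Matrix.kronecker, Matrix.one_apply,
    Fintype.sum_prod_type]

theorem onRight_mulVec (K : Matrix (QIdx d₂) (QIdx d₂) ℂ) (x : QIdx d₁ × QIdx d₂ → ℂ)
    (i : QIdx d₁) (j : QIdx d₂) :
    (onRight K *ᵥ x) (i, j) = (K *ᵥ fun j' => x (i, j')) j := by
  simp [onRight, Matrix.mulVec, dotProduct, Matrix.kronecker, Matrix.one_apply,
    Fintype.sum_prod_type]

/-- Pulling a split assertion back along a Kraus family on the left acts on the left part only,
since `∑ v, (K v)ᴴ * K v = 1`. -/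
theorem sum_conj_onLeft_split {A₁ A₂ V : Type*} {K : V → Matrix (QIdx d₁) (QIdx d₁) ℂ}
    (hK : HasSum (fun v => (K v)ᴴ * K v) 1) (φ₁ : A₁ → InfPred (QIdx d₁))
    (φ₂ : A₂ → InfPred (QIdx d₂)) (g : A₁ → V → A₁) (σ : A₁ × A₂) :
    (InfPred.sum fun v => InfPred.conj (onLeft (K v)) (split φ₁ φ₂ (g σ.1 v, σ.2)))
      = split (fun a => InfPred.sum fun v => InfPred.conj (K v) (φ₁ (g a v))) φ₂ σ := by
  ext x
  simp only [split_form, InfPred.sum, InfPred.conj, onLeft_mulVec]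
  rw [ENNReal.tsum_add, tsum_form_kraus_left hK,
    Summable.tsum_finsetSum fun _ _ => ENNReal.summable]

/-- The mirror image of `sum_conj_onLeft_split`. -/
theorem sum_conj_onRight_split {A₁ A₂ V : Type*} {K : V → Matrix (QIdx d₂) (QIdx d₂) ℂ}
    (hK : HasSum (fun v => (K v)ᴴ * K v) 1) (φ₁ : A₁ → InfPred (QIdx d₁))
    (φ₂ : A₂ → InfPred (QIdx d₂)) (g : A₂ → V → A₂) (σ : A₁ × A₂) :
    (InfPred.sum fun v => InfPred.conj (onRight (K v)) (split φ₁ φ₂ (σ.1, g σ.2 v)))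
      = split φ₁ (fun a => InfPred.sum fun v => InfPred.conj (K v) (φ₂ (g a v))) σ := by
  ext x
  simp only [split_form, InfPred.sum, InfPred.conj, onRight_mulVec]
  rw [ENNReal.tsum_add, tsum_form_kraus_right hK,
    Summable.tsum_finsetSum fun _ _ => ENNReal.summable]

theorem InfPred.sum_unique {ι V : Type*} [Fintype ι] [DecidableEq ι] [Unique V]
    (A : V → InfPred ι) : InfPred.sum A = A default := by
  ext x
  simp [InfPred.sum]

theorem conj_onLeft_split {A₁ A₂ : Type*} (S : Finset Q₁) (U : Matrix.unitaryGroup (RIdx d₁ S) ℂ)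
    (φ₁ : A₁ → InfPred (QIdx d₁)) (φ₂ : A₂ → InfPred (QIdx d₂)) (σ : A₁ × A₂) :
    InfPred.conj (onLeft (extend S U)) (split φ₁ φ₂ σ)
      = split (fun a => InfPred.conj (extend S U) (φ₁ a)) φ₂ σ := by
  have h := sum_conj_onLeft_split (hasSum_unitary S U) φ₁ φ₂ (fun a _ => a) σ
  simp only [InfPred.sum_unique] at h
  exact h

theorem conj_onRight_split {A₁ A₂ : Type*} (S : Finset Q₂)
    (U : Matrix.unitaryGroup (RIdx d₂ S) ℂ)
    (φ₁ : A₁ → InfPred (QIdx d₁)) (φ₂ : A₂ → InfPred (QIdx d₂)) (σ : A₁ × A₂) :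
    InfPred.conj (onRight (extend S U)) (split φ₁ φ₂ σ)
      = split φ₁ (fun a => InfPred.conj (extend S U) (φ₂ a)) σ := by
  have h := sum_conj_onRight_split (hasSum_unitary S U) φ₁ φ₂ (fun a _ => a) σ
  simp only [InfPred.sum_unique] at h
  exact h

/-- Averaging over a distribution on the left leaves the right part alone, as `∑ v, μ v = 1`. -/
theorem sum_smul_split_left {A₁ A₂ V ι κ : Type*} [Fintype ι] [DecidableEq ι] [Fintype κ]
    [DecidableEq κ] (μ : PMF V) (φ₁ : A₁ → InfPred ι) (φ₂ : A₂ → InfPred κ) (g : A₁ → V → A₁)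
    (σ : A₁ × A₂) :
    (InfPred.sum fun v => InfPred.smul (μ v) (split φ₁ φ₂ (g σ.1 v, σ.2)))
      = split (fun a => InfPred.sum fun v => InfPred.smul (μ v) (φ₁ (g a v))) φ₂ σ := by
  ext x
  simp only [split_form, InfPred.sum, InfPred.smul, mul_add]
  rw [ENNReal.tsum_add, ENNReal.tsum_mul_right, μ.tsum_coe, one_mul]
  simp only [Finset.mul_sum]
  rw [Summable.tsum_finsetSum fun _ _ => ENNReal.summable]

/-- The mirror image of `sum_smul_split_left`. -/
theorem sum_smul_split_right {A₁ A₂ V ι κ : Type*} [Fintype ι] [DecidableEq ι] [Fintype κ]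
    [DecidableEq κ] (μ : PMF V) (φ₁ : A₁ → InfPred ι) (φ₂ : A₂ → InfPred κ) (g : A₂ → V → A₂)
    (σ : A₁ × A₂) :
    (InfPred.sum fun v => InfPred.smul (μ v) (split φ₁ φ₂ (σ.1, g σ.2 v)))
      = split φ₁ (fun a => InfPred.sum fun v => InfPred.smul (μ v) (φ₂ (g a v))) σ := by
  ext x
  simp only [split_form, InfPred.sum, InfPred.smul, mul_add]
  rw [ENNReal.tsum_add, ENNReal.tsum_mul_right, μ.tsum_coe, one_mul]
  simp only [Finset.mul_sum]
  rw [Summable.tsum_finsetSum fun _ _ => ENNReal.summable]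

/-- As memories exist and the quantum system has positive dimension, there is a state of mass `1`,
so that `abort` does not terminate almost surely. -/
theorem not_AST_abort {C Val Q : Type*} [Fintype Q] [DecidableEq Q] {d : Q → ℕ} [Nonempty Val]
    (hd : ∀ q, 0 < d q) : ¬ (Cmd.abort : Cmd C Val d).AST := by
  intro h
  obtain ⟨σ⟩ : Nonempty (Mem C Val) := inferInstance
  let i : QIdx d := fun q => ⟨0, hd q⟩
  have hp : (Matrix.diagonal (Pi.single i (1 : ℂ))).PosSemidef :=
    Matrix.PosSemidef.diagonal (Pi.single_nonneg.mpr zero_le_one)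
  have hm : mass (simple σ (Matrix.diagonal (Pi.single i (1 : ℂ)))) = 1 := by
    rw [mass_simple, Matrix.trace_diagonal, Finset.sum_pi_single']
    simp
  have h1 := h _ ⟨posSemidef_simple σ hp, hm.le⟩
  rw [hm] at h1
  simp [Cmd.den, mass] at h1

/-- The weakest precondition of a program on the left is derivable for split postconditions. -/
theorem derivable_wp_left [Nonempty Val] (hd : ∀ q, 0 < d₁ q) {c : Cmd C₁ Val d₁} (hc : c.HAST)
    (φ₁ : Mem C₁ Val → InfPred (QIdx d₁)) (φ₂ : Mem C₂ Val → InfPred (QIdx d₂)) :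
    Derivable s (split (c.wp φ₁) φ₂) c .skip (split φ₁ φ₂) := by
  induction c generalizing φ₁ with
  | skip => exact .skip _
  | abort => exact absurd hc (not_AST_abort hd)
  | assign x e => exact Derivable.assignL x e (split φ₁ φ₂)
  | sample x μ =>
    have h := Derivable.sampleL (s := s) x μ (split φ₁ φ₂)
    rwa [funext (sum_smul_split_left μ φ₁ φ₂ fun σ v => upd σ x v)] at h
  | init S v =>
    refine (Derivable.initL S v (split φ₁ φ₂)).strengthen fun σ => ?_
    have h := sum_conj_onLeft_split (hasSum_initOp S (v σ.1)) φ₁ φ₂ (fun a _ => a) σ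
    exact fun x => (congrArg (fun A => A.form x) h).le
  | apply S U =>
    have h := Derivable.applyL (s := s) S U (split φ₁ φ₂)
    rwa [funext (conj_onLeft_split S U φ₁ φ₂)] at h
  | measure x S M =>
    have h := Derivable.measureL (s := s) x S M (split φ₁ φ₂)
    rwa [funext (sum_conj_onLeft_split (hasSum_extend S M.complete) φ₁ φ₂
      fun σ v => upd σ x v)] at h
  | seq c c' ih ih' =>
    exact .skipEq (.refl _) (.skip_seq _) (.seq (ih hc.2.1 _) (ih' hc.2.2 _))
  | ite b c c' ih ih' =>
    refine .ifL ((ih hc.2.1 φ₁).strengthen (le_guard fun σ hb => ?_))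
      ((ih' hc.2.2 φ₁).strengthen (le_guard fun σ hb => ?_)) <;>
    exact split_congr (by simp [Cmd.wp, hb]) rfl
  | loop b c ih =>
    -- The weakest precondition of the loop is an invariant.
    refine (Derivable.whileL ((ih hc.2 _).strengthen (le_guard fun σ hb => ?_)) hc.1).mono
      (fun _ _ => le_rfl) (le_guard fun σ hb => ?_) <;>
    exact split_congr (by rw [Cmd.wp_loop b c φ₁ σ.1]; simp [hb]) rfl

/-- The mirror image of `derivable_wp_left`. -/
theorem derivable_wp_right [Nonempty Val] (hd : ∀ q, 0 < d₂ q) {c : Cmd C₂ Val d₂} (hc : c.HAST)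
    (φ₁ : Mem C₁ Val → InfPred (QIdx d₁)) (φ₂ : Mem C₂ Val → InfPred (QIdx d₂)) :
    Derivable s (split φ₁ (c.wp φ₂)) .skip c (split φ₁ φ₂) := by
  induction c generalizing φ₂ with
  | skip => exact .skip _
  | abort => exact absurd hc (not_AST_abort hd)
  | assign x e => exact Derivable.assignR x e (split φ₁ φ₂)
  | sample x μ =>
    have h := Derivable.sampleR (s := s) x μ (split φ₁ φ₂)
    rwa [funext (sum_smul_split_right μ φ₁ φ₂ fun σ v => upd σ x v)] at h
  | init S v =>
    refine (Derivable.initR S v (split φ₁ φ₂)).strengthen fun σ => ?_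
    have h := sum_conj_onRight_split (hasSum_initOp S (v σ.2)) φ₁ φ₂ (fun a _ => a) σ
    exact fun x => (congrArg (fun A => A.form x) h).le
  | apply S U =>
    have h := Derivable.applyR (s := s) S U (split φ₁ φ₂)
    rwa [funext (conj_onRight_split S U φ₁ φ₂)] at h
  | measure x S M =>
    have h := Derivable.measureR (s := s) x S M (split φ₁ φ₂)
    rwa [funext (sum_conj_onRight_split (hasSum_extend S M.complete) φ₁ φ₂
      fun σ v => upd σ x v)] at h
  | seq c c' ih ih' =>
    exact .skipEq (.skip_seq _) (.refl _) (.seq (ih hc.2.1 _) (ih' hc.2.2 _))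
  | ite b c c' ih ih' =>
    refine .ifR ((ih hc.2.1 φ₂).strengthen (le_guard fun σ hb => ?_))
      ((ih' hc.2.2 φ₂).strengthen (le_guard fun σ hb => ?_)) <;>
    exact split_congr rfl (by simp [Cmd.wp, hb])
  | loop b c ih =>
    refine (Derivable.whileR ((ih hc.2 _).strengthen (le_guard fun σ hb => ?_)) hc.1).mono
      (fun _ _ => le_rfl) (le_guard fun σ hb => ?_) <;>
    exact split_congr rfl (by rw [Cmd.wp_loop b c φ₂ σ.2]; simp [hb])

/-- A valid precondition of a split postcondition is at least the split of the two weakest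
preconditions, in expectation. -/
theorem expectation_split_wp_le {ψ : RAssn C₁ C₂ Val d₁ d₂} {c₁ : Cmd C₁ Val d₁}
    {c₂ : Cmd C₂ Val d₂} {φ₁ : Mem C₁ Val → InfPred (QIdx d₁)}
    {φ₂ : Mem C₂ Val → InfPred (QIdx d₂)} (h : Valid ψ c₁ c₂ (split φ₁ φ₂))
    {Δ : RMem C₁ C₂ Val → Matrix (QIdx d₁ × QIdx d₂) (QIdx d₁ × QIdx d₂) ℂ} (hΔ : IsState Δ) :
    expectation Δ (split (c₁.wp φ₁) (c₂.wp φ₂)) ≤ expectation Δ ψ := by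
  obtain ⟨Δ', hΔ', hle⟩ := h Δ hΔ
  rwa [expectation_split hΔ'.isState, hΔ'.left, hΔ'.right,
    c₁.isDual.expectation_eq _ (isState_tr₂ hΔ), c₂.isDual.expectation_eq _ (isState_tr₁ hΔ),
    ← expectation_split hΔ] at hle

theorem derivable_of_valid_split [Nonempty Val] (hd₁ : ∀ q, 0 < d₁ q) (hd₂ : ∀ q, 0 < d₂ q)
    {ψ : RAssn C₁ C₂ Val d₁ d₂} {c₁ : Cmd C₁ Val d₁} {c₂ : Cmd C₂ Val d₂} (hc₁ : c₁.HAST)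
    (hc₂ : c₂.HAST) {φ₁ : Mem C₁ Val → InfPred (QIdx d₁)}
    {φ₂ : Mem C₂ Val → InfPred (QIdx d₂)} (h : Valid ψ c₁ c₂ (split φ₁ φ₂)) :
    Derivable s ψ c₁ c₂ (split φ₁ φ₂) :=
  have hwp : Derivable s (split (c₁.wp φ₁) (c₂.wp φ₂)) c₁ c₂ (split φ₁ φ₂) :=
    .skipEq (.seq_skip _) (.skip_seq _)
      (.seq (derivable_wp_left hd₁ hc₁ φ₁ (c₂.wp φ₂)) (derivable_wp_right hd₂ hc₂ φ₁ φ₂))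
  hwp.mono (fun _ hΔ => expectation_split_wp_le h hΔ) fun _ _ => le_rfl

end Derivations

end CqOTL

theorem theorem8p6 {C₁ C₂ Val Q₁ Q₂ : Type*} [Nonempty Val]
    [Fintype Q₁] [DecidableEq Q₁] [Fintype Q₂] [DecidableEq Q₂]
    (d₁ : Q₁ → ℕ) (d₂ : Q₂ → ℕ) (hd₁ : ∀ q, 0 < d₁ q) (hd₂ : ∀ q, 0 < d₂ q)
    (c₁ : CqOTL.Cmd C₁ Val d₁) (c₂ : CqOTL.Cmd C₂ Val d₂) (hc₁ : c₁.HAST) (hc₂ : c₂.HAST)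
    (ψ : CqOTL.RAssn C₁ C₂ Val d₁ d₂)
    (φ₁ : CqOTL.Mem C₁ Val → CqOTL.InfPred (CqOTL.QIdx d₁))
    (φ₂ : CqOTL.Mem C₂ Val → CqOTL.InfPred (CqOTL.QIdx d₂))
    (hvalid : CqOTL.Valid ψ c₁ c₂ (CqOTL.split φ₁ φ₂)) :
    CqOTL.Derivable .full ψ c₁ c₂ (CqOTL.split φ₁ φ₂) ∧
      CqOTL.Derivable .oneSided ψ c₁ c₂ (CqOTL.split φ₁ φ₂) :=
  ⟨CqOTL.derivable_of_valid_split hd₁ hd₂ hc₁ hc₂ hvalid,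
    CqOTL.derivable_of_valid_split hd₁ hd₂ hc₁ hc₂ hvalid⟩
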